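/- Let $n\ge 0$, let $S_n$ be the group of permutations of $[n]=\{1,\dots,n\}$, let $s_i=(i,i+1)$ for $1\le i<n$, and let $\ell(w)$ be the least length of an expression of $w\in S_n$ as a product of the $s_i$. Let $\circ$ be the Demazure product on $S_n$, that is, the unique associative operation such that, for every $w\in S_n$ and every $i$, $w\circ s_i=ws_i$ if $\ell(w)<\ell(ws_i)$ and $w\circ s_i=w$ otherwise, and $s_i\circ w=s_iw$ if $\ell(w)<\ell(s_iw)$ and $s_i\circ w=w$ otherwise. For $x\in S_n$ with $x=x^{-1}$, let $\mathcal B(x)=\{w\in S_n : w^{-1}\circ 1\circ w=x\}$, let $\mathcal A(x)$ be the set of elements of minimal length in $\mathcal B(x)$, and let $\mathcal A(x)^{-1}=\{u^{-1}: u\in\mathcal A(x)\}$. Let $\prec_{\mathcal A}$ be the transitive closure of the relation on finite integer sequences given by $[\,\cdots c,a,b\cdots]\prec_{\mathcal A}[\,\cdots b,c,a\cdots]$ whenever $a\le b\le c$, where the two sequences agree in all the entries not shown. Regard $u\in S_n$ as the sequence $[u(1),\dots,u(n)]$; on $S_n$ the relation $\prec_{\mathcal A}$ is a strict partial order. Let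 $L_x=\{a\in[n] : a\le x(a)\}$ and $R_x=\{b\in[n]: x(b)<b\}$, let $$\mathcal Z_x=\{(a,a')\in L_x\times L_x : a>a'\}\cup\{(b,b')\in R_x\times R_x : b<b'\},$$ and for $u\in S_n$ let $\mathrm{inv}_{\mathcal A}(u;x)=\{(p,q)\in\mathcal Z_x : u^{-1}(p)<u^{-1}(q)\}$ be the $\mathcal A$-inversion set of $u$ relative to $x$. **Proposition.** For each $x\in S_n$ with $x=x^{-1}$, the poset $(\mathcal A(x)^{-1},\prec_{\mathcal A})$ is graded and bounded: it has a least and a greatest element, and the function $\operatorname{rank}(u)=|\mathrm{inv}_{\mathcal A}(u;x)|$ satisfies $\operatorname{rank}(v)=\operatorname{rank}(u)+1$ whenever $v$ covers $u$ in this poset. -/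

import Mathlib

/-! ### The symmetric group as a Coxeter group

`S_n` is `Equiv.Perm (Fin n)`, with `(u * v) i = u (v i)`; the letters `1, …, n` are shifted to
`0, …, n - 1`. -/

/-- The simple transposition interchanging the `i`-th and the `(i+1)`-st letter. -/
def simpleRefl {n : ℕ} (i : Fin (n - 1)) : Equiv.Perm (Fin n) :=
  Equiv.swap ⟨i.1, by omega⟩ ⟨i.1 + 1, by omega⟩

/-- The product `s_{i₁} s_{i₂} ⋯ s_{iₖ}` of a word in the simple transpositions. -/
def wordProd {n : ℕ} (l : List (Fin (n - 1))) : Equiv.Perm (Fin n) :=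
  (l.map simpleRefl).prod

/-- The Coxeter length: the least number of letters in a word with product `w`. -/
noncomputable def coxLength {n : ℕ} (w : Equiv.Perm (Fin n)) : ℕ :=
  sInf {k | ∃ l : List (Fin (n - 1)), wordProd l = w ∧ l.length = k}

/-- Reduced words: words for `w` of shortest possible length. -/
def IsReducedWord {n : ℕ} (l : List (Fin (n - 1))) (w : Equiv.Perm (Fin n)) : Prop :=
  wordProd l = w ∧ l.length = coxLength w

/-- The simple transpositions generate `S_n`. -/
theorem exists_word {n : ℕ} (w : Equiv.Perm (Fin n)) :
    ∃ l : List (Fin (n - 1)), wordProd l = w := by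
  cases n with
  | zero => exact ⟨[], Subsingleton.elim _ _⟩
  | succ m =>
    have h : w ∈ Submonoid.closure
        (Set.range fun i : Fin m => Equiv.swap i.castSucc i.succ) := by
      rw [Equiv.Perm.mclosure_swap_castSucc_succ]; trivial
    induction h using Submonoid.closure_induction with
    | mem y hy =>
      obtain ⟨i, rfl⟩ := hy
      exact ⟨[i], by simp only [wordProd, List.map_cons, List.map_nil, List.prod_cons,
        List.prod_nil, mul_one]; rfl⟩
    | one => exact ⟨[], rfl⟩
    | mul y z _ _ hy hz =>
      obtain ⟨l, rfl⟩ := hy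
      obtain ⟨l', rfl⟩ := hz
      exact ⟨l ++ l', by simp [wordProd]⟩

theorem exists_reducedWord {n : ℕ} (w : Equiv.Perm (Fin n)) :
    ∃ l : List (Fin (n - 1)), IsReducedWord l w := by
  obtain ⟨l, hl⟩ := exists_word w
  exact Nat.sInf_mem (s := {k | ∃ l : List (Fin (n - 1)), wordProd l = w ∧ l.length = k})
    ⟨_, l, hl, rfl⟩

/-! ### Demazure product, Hecke atoms and atoms -/

open Classical in
/-- `w ∘ s` for a simple transposition `s`: it is `ws` if `ℓ(w) < ℓ(ws)`, and `w` otherwise. -/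
noncomputable def demStep {n : ℕ} (w : Equiv.Perm (Fin n)) (i : Fin (n - 1)) :
    Equiv.Perm (Fin n) :=
  if coxLength w < coxLength (w * simpleRefl i) then w * simpleRefl i else w

/-- The Demazure product `u ∘ v = (⋯((u ∘ s₁) ∘ s₂) ⋯) ∘ sₖ`, where `s₁ s₂ ⋯ sₖ` is a reduced
expression for `v`. (The value does not depend on the reduced expression, and this is the unique
associative operation that extends `demStep`.) -/
noncomputable def demProd {n : ℕ} (u v : Equiv.Perm (Fin n)) : Equiv.Perm (Fin n) :=
  (Classical.choose (exists_reducedWord v)).foldl demStep u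

/-- The operation `(x, w) ↦ w⁻¹ ∘ x ∘ w`, for the trivial diagram automorphism. -/
noncomputable def demAct {n : ℕ} (x w : Equiv.Perm (Fin n)) : Equiv.Perm (Fin n) :=
  demProd (demProd w⁻¹ x) w

/-- The set `B(x, y)` of Hecke atoms of `y` relative to `x`. -/
def heckeAtoms {n : ℕ} (x y : Equiv.Perm (Fin n)) : Set (Equiv.Perm (Fin n)) :=
  {w | demAct x w = y}

/-- The set `A(x, y)` of atoms of `y` relative to `x`: the elements of minimal length in
`B(x, y)`. -/
def atomsRel {n : ℕ} (x y : Equiv.Perm (Fin n)) : Set (Equiv.Perm (Fin n)) :=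
  {w | w ∈ heckeAtoms x y ∧ ∀ v ∈ heckeAtoms x y, coxLength w ≤ coxLength v}

/-- The set `A(y) = A(1, y)` of atoms of `y`. -/
def involutionAtoms {n : ℕ} (y : Equiv.Perm (Fin n)) : Set (Equiv.Perm (Fin n)) :=
  atomsRel 1 y

/-! ### The order `≺_A` -/

/-- The generating relation `[⋯ c, a, b ⋯] → [⋯ b, c, a ⋯]` with `a ≤ b ≤ c` on integer
sequences. -/
def SeqStep (l m : List ℤ) : Prop :=
  ∃ (p q : List ℤ) (a b c : ℤ), a ≤ b ∧ b ≤ c ∧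
    l = p ++ [c, a, b] ++ q ∧ m = p ++ [b, c, a] ++ q

/-- `≺_A` on integer sequences. -/
def SeqPrec : List ℤ → List ℤ → Prop := Relation.TransGen SeqStep

/-- The one-line representation of a permutation. -/
def oneLine {n : ℕ} (u : Equiv.Perm (Fin n)) : List ℤ :=
  List.ofFn fun i => ((u i : ℕ) : ℤ)

/-- `≺_A` on permutations. -/
def PermPrec {n : ℕ} (u v : Equiv.Perm (Fin n)) : Prop := SeqPrec (oneLine u) (oneLine v)

theorem oneLine_nodup {n : ℕ} (u : Equiv.Perm (Fin n)) : (oneLine u).Nodup := by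
  refine List.nodup_ofFn.2 fun i j h => u.injective (Fin.ext ?_)
  exact_mod_cast h

theorem SeqStep.nodup_lt {l m : List ℤ} (h : SeqStep l m) (hl : l.Nodup) :
    m.Nodup ∧ m < l := by
  obtain ⟨p, q, a, b, c, hab, hbc, rfl, rfl⟩ := h
  have hperm : (p ++ [c, a, b] ++ q).Perm (p ++ [b, c, a] ++ q) := by
    refine List.Perm.append_right q (List.Perm.append_left p ?_)
    exact (List.perm_append_comm (l₁ := [c, a]) (l₂ := [b]))
  refine ⟨hperm.nodup_iff.1 hl, ?_⟩
  have hne : b ≠ c := by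
    rintro rfl
    simp [List.nodup_append] at hl
  have hlt : b < c := lt_of_le_of_ne hbc hne
  clear hperm hl
  induction p with
  | nil => exact List.Lex.rel hlt
  | cons d p ih => exact List.Lex.cons ih

theorem SeqPrec.nodup_lt {l m : List ℤ} (h : SeqPrec l m) (hl : l.Nodup) :
    m.Nodup ∧ m < l := by
  induction h with
  | single h => exact h.nodup_lt hl
  | tail _ h ih =>
    obtain ⟨h1, h2⟩ := h.nodup_lt ih.1
    exact ⟨h1, lt_trans h2 ih.2⟩

theorem PermPrec.irrefl {n : ℕ} (u : Equiv.Perm (Fin n)) : ¬ PermPrec u u := fun h =>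
  lt_irrefl _ (SeqPrec.nodup_lt h (oneLine_nodup u)).2

theorem PermPrec.trans {n : ℕ} {u v w : Equiv.Perm (Fin n)} (h : PermPrec u v)
    (h' : PermPrec v w) : PermPrec u w :=
  Relation.TransGen.trans h h'

/-- The set `A(x)⁻¹` of the inverses of the atoms of `x`, as a type. -/
def InvAtoms {n : ℕ} (x : Equiv.Perm (Fin n)) : Type :=
  {u : Equiv.Perm (Fin n) // u⁻¹ ∈ involutionAtoms x}

/-- The poset `(A(x)⁻¹, ≺_A)`: `u < v` means `u ≺_A v`. -/
instance InvAtoms.instPartialOrder {n : ℕ} (x : Equiv.Perm (Fin n)) :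
    PartialOrder (InvAtoms x) where
  le u v := u = v ∨ PermPrec u.1 v.1
  lt u v := PermPrec u.1 v.1
  le_refl u := Or.inl rfl
  le_trans u v w h h' := by
    rcases h with rfl | h
    · exact h'
    · rcases h' with rfl | h'
      · exact Or.inr h
      · exact Or.inr (h.trans h')
  lt_iff_le_not_ge u v := by
    constructor
    · intro h
      refine ⟨Or.inr h, ?_⟩
      rintro (rfl | h')
      · exact PermPrec.irrefl _ h
      · exact PermPrec.irrefl _ (h.trans h')
    · rintro ⟨rfl | h, h'⟩
      · exact absurd (Or.inl rfl) h'
      · exact h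
  le_antisymm u v h h' := by
    rcases h with rfl | h
    · rfl
    · rcases h' with h' | h'
      · exact h'.symm
      · exact absurd (h.trans h') (PermPrec.irrefl _)

/-! ### `A`-inversion sets -/

/-- The set of all `a` with `a ≤ x(a)`. -/
def leftSet {n : ℕ} (x : Equiv.Perm (Fin n)) : Finset (Fin n) :=
  Finset.univ.filter fun a => a ≤ x a

/-- The set of all `b` with `x(b) < b`. -/
def rightSet {n : ℕ} (x : Equiv.Perm (Fin n)) : Finset (Fin n) :=
  Finset.univ.filter fun b => x b < b

/-- The pairs `(a, a')` in `leftSet x` with `a > a'` and the pairs `(b, b')` in `rightSet x` with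
`b < b'`. -/
def pairSet {n : ℕ} (x : Equiv.Perm (Fin n)) : Finset (Fin n × Fin n) :=
  (leftSet x ×ˢ leftSet x).filter (fun p => p.2 < p.1) ∪
    (rightSet x ×ˢ rightSet x).filter (fun p => p.1 < p.2)

/-- The `A`-inversion set of `u` relative to `x`. -/
def atomInv {n : ℕ} (u x : Equiv.Perm (Fin n)) : Finset (Fin n × Fin n) :=
  (pairSet x).filter fun p => u⁻¹ p.1 < u⁻¹ p.2

/-! ### Graded and bounded posets -/

/-- `rank` is a rank function on the poset `P`: it increases by one along each covering. -/
def IsRankFunction {P : Type*} [PartialOrder P] (rank : P → ℕ) : Prop :=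
  ∀ u v : P, u ⋖ v → rank v = rank u + 1

/-- A poset is graded if it has a rank function. -/
def IsGradedPoset (P : Type*) [PartialOrder P] : Prop :=
  ∃ rank : P → ℕ, IsRankFunction rank

/-- A poset is bounded if it has a least and a greatest element. -/
def IsBoundedPoset (P : Type*) [PartialOrder P] : Prop :=
  (∃ a : P, IsBot a) ∧ ∃ b : P, IsTop b

/-! The proof replaces the definition of atoms by explicit conditions on the one-line word of the
inverse, and then studies the moves on words.

Left and right Demazure steps commute, so `w⁻¹ ∘ 1 ∘ w` is obtained from `1` by steps `x ↦ s ∘ x ∘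
s` along a reduced word of `w`. A step at an ascent of `x` raises `involutionWeight` by exactly 2;
any other step does nothing. Hence Hecke atoms of `x` have length at least half the weight of `x`,
with equality exactly when every step is an ascent. The conditions `AtomLike` hold for the identity,
survive ascending steps and can be undone along descents, so they describe the atoms
(`mem_involutionAtoms_iff`).

In the word of an inverse atom, an adjacent descent `c, a` must be a two-cycle of `x`
(`AtomLike.apply_eq_of_adjacent`). A move `c, a, b → b, c, a` therefore carries the letter `b`
across a cycle, which preserves the conditions in both directions. Since `a` lies in `leftSet x` and
`c` in `rightSet x`, exactly one new pair enters the inversion set. Every step stays among inverse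
atoms, so covers are single moves, and the cardinality is a rank function.

For the bounds, finiteness leads from any element down to one without consecutive pattern `b, c, a`.
Such a word is forced: the two letters of a cycle are adjacent and the cycles are sorted by their
minima (`AtomLike.eq_of_avoidsBCA`). So there is a unique bottom. Reversing both letters and
positions gives the top. -/

/-! ### Simple transpositions -/

/-- The smaller letter moved by `simpleRefl i`. -/
def loLetter {n : ℕ} (i : Fin (n - 1)) : Fin n := ⟨i.1, by omega⟩

/-- The larger letter moved by `simpleRefl i`. -/
def hiLetter {n : ℕ} (i : Fin (n - 1)) : Fin n := ⟨i.1 + 1, by omega⟩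

section SimpleRefl

variable {n : ℕ} (i : Fin (n - 1))

theorem loLetter_lt_hiLetter : loLetter i < hiLetter i := by
  simp [loLetter, hiLetter, Fin.lt_def]

theorem le_loLetter_of_lt_hiLetter {i : Fin (n - 1)} {p : Fin n} (h : p < hiLetter i) :
    p ≤ loLetter i := by
  simp only [loLetter, hiLetter, Fin.lt_def, Fin.le_def] at *; omega

theorem hiLetter_le_of_loLetter_lt {i : Fin (n - 1)} {p : Fin n} (h : loLetter i < p) :
    hiLetter i ≤ p := by
  simp only [loLetter, hiLetter, Fin.lt_def, Fin.le_def] at *; omega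

@[simp] theorem simpleRefl_loLetter : simpleRefl i (loLetter i) = hiLetter i :=
  Equiv.swap_apply_left _ _

@[simp] theorem simpleRefl_hiLetter : simpleRefl i (hiLetter i) = loLetter i :=
  Equiv.swap_apply_right _ _

theorem simpleRefl_of_ne {i : Fin (n - 1)} {p : Fin n} (h : p ≠ loLetter i)
    (h' : p ≠ hiLetter i) : simpleRefl i p = p :=
  Equiv.swap_apply_of_ne_of_ne h h'

@[simp] theorem simpleRefl_simpleRefl (p : Fin n) : simpleRefl i (simpleRefl i p) = p :=
  DFunLike.congr_fun (Equiv.swap_mul_self (loLetter i) (hiLetter i)) p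

@[simp] theorem simpleRefl_mul_self : simpleRefl i * simpleRefl i = 1 :=
  Equiv.swap_mul_self _ _

@[simp] theorem simpleRefl_inv : (simpleRefl i)⁻¹ = simpleRefl i :=
  Equiv.swap_inv _ _

theorem simpleRefl_eq_iff (p q : Fin n) : simpleRefl i p = q ↔ p = simpleRefl i q := by
  constructor <;> rintro rfl <;> simp

/-- A simple transposition preserves all strict inequalities but one. -/
theorem simpleRefl_lt {i : Fin (n - 1)} {p q : Fin n} (h : p < q) :
    simpleRefl i p < simpleRefl i q ∨ (p = loLetter i ∧ q = hiLetter i) := by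
  have h1 := simpleRefl_loLetter i
  have h2 := simpleRefl_hiLetter i
  have h3 := @simpleRefl_of_ne n i p
  have h4 := @simpleRefl_of_ne n i q
  simp only [loLetter, hiLetter, Fin.lt_def, Fin.ext_iff, ne_eq] at *
  grind

theorem lt_of_simpleRefl_lt {i : Fin (n - 1)} {p q : Fin n}
    (h : simpleRefl i p < simpleRefl i q) : p < q ∨ (p = hiLetter i ∧ q = loLetter i) := by
  rcases simpleRefl_lt (i := i) h with h | h
  · left; simpa using h
  · right; simpa [simpleRefl_eq_iff] using h

theorem le_of_simpleRefl_le {i : Fin (n - 1)} {p q : Fin n}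
    (h : simpleRefl i p ≤ simpleRefl i q) : p ≤ q ∨ (p = hiLetter i ∧ q = loLetter i) := by
  rcases h.eq_or_lt with h | h
  · exact Or.inl ((simpleRefl i).injective h).le
  · exact (lt_of_simpleRefl_lt h).imp le_of_lt id

end SimpleRefl

/-! ### Inversions and the Coxeter length -/

/-- The inversions of a permutation. -/
def inversions {n : ℕ} (w : Equiv.Perm (Fin n)) : Finset (Fin n × Fin n) :=
  Finset.univ.filter fun p => p.1 < p.2 ∧ w p.2 < w p.1

section Length

variable {n : ℕ}

theorem mem_inversions {w : Equiv.Perm (Fin n)} {p : Fin n × Fin n} :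
    p ∈ inversions w ↔ p.1 < p.2 ∧ w p.2 < w p.1 := by
  simp [inversions]

/-- Relabelling both coordinates by `simpleRefl i` carries the inversions of `w` to those of the
product; the only further inversion is the pair `(loLetter i, hiLetter i)`. -/
theorem card_inversions_mul_simpleRefl {w : Equiv.Perm (Fin n)} {i : Fin (n - 1)}
    (h : w (loLetter i) < w (hiLetter i)) :
    (inversions (w * simpleRefl i)).card = (inversions w).card + 1 := by
  have key : inversions (w * simpleRefl i) = insert (loLetter i, hiLetter i)
      ((inversions w).map
        ((simpleRefl i).prodCongr (simpleRefl i)).toEmbedding) := by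
    ext ⟨p, q⟩
    simp only [mem_inversions, Finset.mem_insert, Finset.mem_map_equiv, Equiv.Perm.mul_apply, Equiv.prodCongr_symm, Equiv.prodCongr_apply,
      Prod.map_apply, Prod.mk.injEq]
    have hs : Equiv.symm (simpleRefl i) = simpleRefl i := simpleRefl_inv i
    rw [hs]
    constructor
    · rintro ⟨h1, h2⟩
      rcases simpleRefl_lt (i := i) h1 with h3 | h3
      · exact Or.inr ⟨h3, h2⟩
      · exact Or.inl h3
    · rintro (⟨rfl, rfl⟩ | ⟨h1, h2⟩)
      · simpa [loLetter_lt_hiLetter] using h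
      · rcases lt_of_simpleRefl_lt h1 with h3 | ⟨rfl, rfl⟩
        · exact ⟨h3, h2⟩
        · simp [h.not_gt] at h2
  rw [key, Finset.card_insert_of_notMem, Finset.card_map]
  simp only [mem_inversions, Finset.mem_map_equiv, Equiv.prodCongr_symm,
    Equiv.prodCongr_apply, Prod.map_apply]
  have hs : Equiv.symm (simpleRefl i) = simpleRefl i := simpleRefl_inv i
  rw [hs]
  simp [(loLetter_lt_hiLetter i).not_gt]

theorem card_inversions_inv (w : Equiv.Perm (Fin n)) :
    (inversions w⁻¹).card = (inversions w).card := by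
  refine Finset.card_bij' (fun p _ => (w⁻¹ p.2, w⁻¹ p.1)) (fun p _ => (w p.2, w p.1)) ?_ ?_ ?_ ?_
    <;> simp +contextual [mem_inversions]

theorem mul_simpleRefl_lt_or_gt (w : Equiv.Perm (Fin n)) (i : Fin (n - 1)) :
    w (loLetter i) < w (hiLetter i) ∨ w (hiLetter i) < w (loLetter i) :=
  by
  have := w.injective.ne (loLetter_lt_hiLetter i).ne
  exact lt_or_gt_of_ne this

theorem card_inversions_of_descent {w : Equiv.Perm (Fin n)} {i : Fin (n - 1)}
    (h : w (hiLetter i) < w (loLetter i)) :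
    (inversions w).card = (inversions (w * simpleRefl i)).card + 1 := by
  have := card_inversions_mul_simpleRefl (w := w * simpleRefl i) (i := i) (by simpa using h)
  rwa [mul_assoc, simpleRefl_mul_self, mul_one] at this

@[simp] theorem inversions_one : inversions (1 : Equiv.Perm (Fin n)) = ∅ := by
  ext ⟨p, q⟩; simpa [mem_inversions] using le_of_lt

theorem wordProd_concat (l : List (Fin (n - 1))) (i : Fin (n - 1)) :
    wordProd (l ++ [i]) = wordProd l * simpleRefl i := by
  simp [wordProd]

theorem card_inversions_wordProd_le (l : List (Fin (n - 1))) :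
    (inversions (wordProd l)).card ≤ l.length := by
  induction l using List.reverseRecOn with
  | nil => simp [wordProd]
  | append_singleton l i ih =>
    rw [wordProd_concat, List.length_append, List.length_singleton]
    rcases mul_simpleRefl_lt_or_gt (wordProd l) i with h | h
    · rw [card_inversions_mul_simpleRefl h]; omega
    · have := card_inversions_of_descent h; omega

theorem exists_descent {w : Equiv.Perm (Fin n)} (hw : w ≠ 1) :
    ∃ i, w (hiLetter i) < w (loLetter i) := by
  by_contra! h
  refine hw ?_
  have hm : StrictMono w := by
    cases n with
    | zero => intro a; exact a.elim0
    | succ m =>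
      rw [Fin.strictMono_iff_lt_succ]
      intro i
      exact lt_of_le_of_ne (h i) fun e => (loLetter_lt_hiLetter (n := m + 1) i).ne (w.injective e)
  exact Equiv.ext (congrFun hm.eq_id)

theorem exists_word_card_inversions (w : Equiv.Perm (Fin n)) :
    ∃ l : List (Fin (n - 1)), wordProd l = w ∧ l.length = (inversions w).card := by
  induction hk : (inversions w).card generalizing w with
  | zero =>
    by_cases hw : w = 1
    · exact ⟨[], by simp [wordProd, hw]⟩
    · obtain ⟨i, hi⟩ := exists_descent hw
      have := card_inversions_of_descent hi; omega
  | succ k ih =>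
    have hw : w ≠ 1 := by rintro rfl; simp at hk
    obtain ⟨i, hi⟩ := exists_descent hw
    have := card_inversions_of_descent hi
    obtain ⟨l, hl, hlen⟩ := ih (w * simpleRefl i) (by omega)
    exact ⟨l ++ [i], by rw [wordProd_concat, hl, mul_assoc, simpleRefl_mul_self, mul_one],
      by simp [hlen]⟩

theorem coxLength_eq_card_inversions (w : Equiv.Perm (Fin n)) :
    coxLength w = (inversions w).card := by
  obtain ⟨l, hl⟩ := exists_reducedWord w
  refine le_antisymm ?_ (by rw [← hl.2, ← hl.1]; exact card_inversions_wordProd_le l)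
  exact Nat.sInf_le (exists_word_card_inversions w)

theorem coxLength_lt_iff (w : Equiv.Perm (Fin n)) (i : Fin (n - 1)) :
    coxLength w < coxLength (w * simpleRefl i) ↔ w (loLetter i) < w (hiLetter i) := by
  simp only [coxLength_eq_card_inversions]
  rcases mul_simpleRefl_lt_or_gt w i with h | h
  · simp [card_inversions_mul_simpleRefl h, h]
  · simp [card_inversions_of_descent h, h.le]

theorem IsReducedWord.of_concat {l : List (Fin (n - 1))} {i : Fin (n - 1)}
    {w : Equiv.Perm (Fin n)} (h : IsReducedWord (l ++ [i]) w) :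
    w (hiLetter i) < w (loLetter i) ∧ IsReducedWord l (w * simpleRefl i) := by
  obtain ⟨h1, h2⟩ := h
  rw [wordProd_concat] at h1
  have h3 : wordProd l = w * simpleRefl i := by
    rw [← h1, mul_assoc, simpleRefl_mul_self, mul_one]
  have h4 := card_inversions_wordProd_le l
  rw [h3] at h4
  rw [coxLength_eq_card_inversions, List.length_append, List.length_singleton] at h2
  rcases mul_simpleRefl_lt_or_gt w i with h | h
  · have := card_inversions_mul_simpleRefl h; omega
  · have := card_inversions_of_descent h
    exact ⟨h, h3, by rw [coxLength_eq_card_inversions]; omega⟩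

end Length

/-! ### The Demazure conjugation -/

section Demazure

variable {n : ℕ}

theorem demStep_of_lt {w : Equiv.Perm (Fin n)} {i : Fin (n - 1)}
    (h : w (loLetter i) < w (hiLetter i)) : demStep w i = w * simpleRefl i := by
  rw [demStep, if_pos ((coxLength_lt_iff w i).2 h)]

theorem demStep_of_gt {w : Equiv.Perm (Fin n)} {i : Fin (n - 1)}
    (h : w (hiLetter i) < w (loLetter i)) : demStep w i = w := by
  rw [demStep, if_neg (by rw [coxLength_lt_iff]; exact h.not_gt)]

/-- `s ∘ w` for a simple transposition `s`. -/
noncomputable def leftDemStep (w : Equiv.Perm (Fin n)) (i : Fin (n - 1)) : Equiv.Perm (Fin n) :=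
  (demStep w⁻¹ i)⁻¹

theorem leftDemStep_of_lt {w : Equiv.Perm (Fin n)} {i : Fin (n - 1)}
    (h : w⁻¹ (loLetter i) < w⁻¹ (hiLetter i)) : leftDemStep w i = simpleRefl i * w := by
  rw [leftDemStep, demStep_of_lt h]; simp

theorem leftDemStep_of_gt {w : Equiv.Perm (Fin n)} {i : Fin (n - 1)}
    (h : w⁻¹ (hiLetter i) < w⁻¹ (loLetter i)) : leftDemStep w i = w := by
  rw [leftDemStep, demStep_of_gt h]; simp

/-- This is the only instance of associativity of the Demazure product that is needed. A step on one
side can affect the ascent test on the other only if `u` maps the two letters of `j` onto the two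
letters of `i`. If it does so in order, both composites equal `u * simpleRefl j`; if in reverse
order, nothing moves. -/
theorem leftDemStep_demStep (u : Equiv.Perm (Fin n)) (i j : Fin (n - 1)) :
    leftDemStep (demStep u j) i = demStep (leftDemStep u i) j := by
  by_cases h1 : u (loLetter j) = loLetter i ∧ u (hiLetter j) = hiLetter i
  · have e1 := Equiv.Perm.inv_eq_iff_eq.2 h1.1.symm
    have e2 := Equiv.Perm.inv_eq_iff_eq.2 h1.2.symm
    have e : u * simpleRefl j = simpleRefl i * u := by
      have := Equiv.mul_swap_eq_swap_mul u (loLetter j) (hiLetter j)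
      rwa [h1.1, h1.2] at this
    have hr : demStep u j = u * simpleRefl j :=
      demStep_of_lt (by rw [h1.1, h1.2]; exact loLetter_lt_hiLetter i)
    have hl : leftDemStep u i = u * simpleRefl j := by
      rw [e]; apply leftDemStep_of_lt
      rw [e1, e2]; exact loLetter_lt_hiLetter j
    rw [hr, hl, demStep_of_gt, leftDemStep_of_gt]
    · simp only [mul_inv_rev, simpleRefl_inv, Equiv.Perm.mul_apply, e1, e2]
      simp [loLetter_lt_hiLetter]
    · simp [h1, loLetter_lt_hiLetter]
  by_cases h2 : u (loLetter j) = hiLetter i ∧ u (hiLetter j) = loLetter i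
  · have hr : demStep u j = u :=
      demStep_of_gt (by rw [h2.1, h2.2]; exact loLetter_lt_hiLetter i)
    have hl : leftDemStep u i = u := by
      apply leftDemStep_of_gt
      rw [Equiv.Perm.inv_eq_iff_eq.2 h2.1.symm, Equiv.Perm.inv_eq_iff_eq.2 h2.2.symm]
      exact loLetter_lt_hiLetter j
    rw [hr, hl, hr]
  have h1' : ¬ (u⁻¹ (loLetter i) = loLetter j ∧ u⁻¹ (hiLetter i) = hiLetter j) := by
    simp only [Equiv.Perm.inv_eq_iff_eq]; rintro ⟨a, b⟩; exact h1 ⟨a.symm, b.symm⟩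
  have h2' : ¬ (u⁻¹ (hiLetter i) = loLetter j ∧ u⁻¹ (loLetter i) = hiLetter j) := by
    simp only [Equiv.Perm.inv_eq_iff_eq]; rintro ⟨a, b⟩; exact h2 ⟨a.symm, b.symm⟩
  rcases mul_simpleRefl_lt_or_gt u j with hr | hr <;>
    rcases mul_simpleRefl_lt_or_gt u⁻¹ i with hl | hl
  · rw [demStep_of_lt hr, leftDemStep_of_lt hl, leftDemStep_of_lt, demStep_of_lt, mul_assoc]
    · exact (simpleRefl_lt hr).resolve_right h1
    · simpa using (simpleRefl_lt hl).resolve_right h1'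
  · rw [demStep_of_lt hr, leftDemStep_of_gt hl, leftDemStep_of_gt, demStep_of_lt hr]
    simpa using (simpleRefl_lt hl).resolve_right h2'
  · rw [demStep_of_gt hr, leftDemStep_of_lt hl, demStep_of_gt]
    exact (simpleRefl_lt hr).resolve_right fun h => h2 h.symm
  · rw [demStep_of_gt hr, leftDemStep_of_gt hl, demStep_of_gt hr]

/-- `s ∘ x ∘ s` for a simple transposition `s`. -/
noncomputable def conjDemStep (x : Equiv.Perm (Fin n)) (i : Fin (n - 1)) : Equiv.Perm (Fin n) :=
  demStep (leftDemStep x i) i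

theorem foldl_demStep_one {l : List (Fin (n - 1))} {w : Equiv.Perm (Fin n)}
    (h : IsReducedWord l w) : l.foldl demStep 1 = w := by
  induction l using List.reverseRecOn generalizing w with
  | nil => simpa [wordProd] using h.1
  | append_singleton l i ih =>
    obtain ⟨h1, h2⟩ := h.of_concat
    rw [List.foldl_append, ih h2, List.foldl_cons, List.foldl_nil, demStep_of_lt (by simpa using h1),
      mul_assoc, simpleRefl_mul_self, mul_one]

theorem foldl_leftDemStep (l : List (Fin (n - 1))) (u : Equiv.Perm (Fin n)) :
    l.foldl leftDemStep u⁻¹ = (l.foldl demStep u)⁻¹ := by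
  induction l generalizing u with
  | nil => rfl
  | cons i l ih => rw [List.foldl_cons, leftDemStep, inv_inv, ih, List.foldl_cons]

theorem foldl_demStep_leftDemStep (l : List (Fin (n - 1))) (u : Equiv.Perm (Fin n))
    (i : Fin (n - 1)) : l.foldl demStep (leftDemStep u i) = leftDemStep (l.foldl demStep u) i := by
  induction l generalizing u with
  | nil => rfl
  | cons j l ih => rw [List.foldl_cons, ← leftDemStep_demStep, ih, List.foldl_cons]

/-- Commuting the right steps past the left ones pairs the two steps belonging to each letter of the
word. -/
theorem foldl_demStep_foldl_leftDemStep (l : List (Fin (n - 1))) (u : Equiv.Perm (Fin n)) :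
    l.foldl demStep (l.foldl leftDemStep u) = l.foldl conjDemStep u := by
  induction l using List.reverseRecOn with
  | nil => rfl
  | append_singleton l i ih =>
    simp only [List.foldl_append, List.foldl_cons, List.foldl_nil]
    rw [foldl_demStep_leftDemStep, ih, conjDemStep]

theorem demProd_one (u : Equiv.Perm (Fin n)) : demProd u 1 = u := by
  have h := Classical.choose_spec (exists_reducedWord (1 : Equiv.Perm (Fin n)))
  have h2 := h.2
  rw [coxLength_eq_card_inversions, inversions_one, Finset.card_empty,
    List.length_eq_zero_iff] at h2
  rw [demProd, h2, List.foldl_nil]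

/-- Taking the reduced word chosen inside `demProd` avoids having to show that the product is
independent of the choice. -/
theorem exists_demAct_one_eq (w : Equiv.Perm (Fin n)) :
    ∃ l, IsReducedWord l w ∧ demAct 1 w = l.foldl conjDemStep 1 := by
  refine ⟨_, Classical.choose_spec (exists_reducedWord w), ?_⟩
  have h := foldl_demStep_one (Classical.choose_spec (exists_reducedWord w))
  have h2 := foldl_leftDemStep (Classical.choose (exists_reducedWord w)) 1
  rw [h, inv_one] at h2
  rw [demAct, demProd_one, demProd, ← foldl_demStep_foldl_leftDemStep, h2]

end Demazure

/-! ### Demazure conjugation of involutions -/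

section Involution

variable {n : ℕ}

theorem conjDemStep_of_gt {x : Equiv.Perm (Fin n)} (hx : x⁻¹ = x) {i : Fin (n - 1)}
    (h : x (hiLetter i) < x (loLetter i)) : conjDemStep x i = x := by
  rw [conjDemStep, leftDemStep_of_gt (by rwa [hx]), demStep_of_gt h]

theorem conjDemStep_of_fixed {x : Equiv.Perm (Fin n)} (hx : x⁻¹ = x) {i : Fin (n - 1)}
    (h : x (loLetter i) = loLetter i ∧ x (hiLetter i) = hiLetter i) :
    conjDemStep x i = x * simpleRefl i := by
  have h1 : leftDemStep x i = simpleRefl i * x :=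
    leftDemStep_of_lt (by rw [hx, h.1, h.2]; exact loLetter_lt_hiLetter i)
  have e : simpleRefl i * x = x * simpleRefl i := by
    have := Equiv.mul_swap_eq_swap_mul x (loLetter i) (hiLetter i)
    rw [h.1, h.2] at this
    exact this.symm
  rw [conjDemStep, h1, e, demStep_of_gt]
  simp [h, loLetter_lt_hiLetter]

theorem conjDemStep_of_lt {x : Equiv.Perm (Fin n)} (hx : x⁻¹ = x) {i : Fin (n - 1)}
    (h : x (loLetter i) < x (hiLetter i))
    (h' : ¬ (x (loLetter i) = loLetter i ∧ x (hiLetter i) = hiLetter i)) :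
    conjDemStep x i = simpleRefl i * x * simpleRefl i := by
  rw [conjDemStep, leftDemStep_of_lt (by rwa [hx]), demStep_of_lt]
  exact (simpleRefl_lt h).resolve_right h'

theorem conjDemStep_inv {x : Equiv.Perm (Fin n)} (hx : x⁻¹ = x) (i : Fin (n - 1)) :
    (conjDemStep x i)⁻¹ = conjDemStep x i := by
  rcases mul_simpleRefl_lt_or_gt x i with h | h
  · by_cases h' : x (loLetter i) = loLetter i ∧ x (hiLetter i) = hiLetter i
    · have e := Equiv.mul_swap_eq_swap_mul x (loLetter i) (hiLetter i)
      rw [h'.1, h'.2] at e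
      rw [conjDemStep_of_fixed hx h', mul_inv_rev, hx, simpleRefl_inv]
      exact e.symm
    · rw [conjDemStep_of_lt hx h h', mul_inv_rev, mul_inv_rev, hx, simpleRefl_inv, mul_assoc]
  · rw [conjDemStep_of_gt hx h, hx]

theorem foldl_conjDemStep_inv (l : List (Fin (n - 1))) :
    (l.foldl conjDemStep 1)⁻¹ = l.foldl conjDemStep 1 := by
  induction l using List.reverseRecOn with
  | nil => simp
  | append_singleton l i ih =>
    rw [List.foldl_append, List.foldl_cons, List.foldl_nil, conjDemStep_inv ih]

/-- The lower elements of the two-cycles of an involution. -/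
def excedances (x : Equiv.Perm (Fin n)) : Finset (Fin n) :=
  Finset.univ.filter fun a => a < x a

theorem mem_excedances {x : Equiv.Perm (Fin n)} {a : Fin n} : a ∈ excedances x ↔ a < x a := by
  simp [excedances]

/-- Twice the involution length: the inversions plus the two-cycles. -/
def involutionWeight (x : Equiv.Perm (Fin n)) : ℕ :=
  (inversions x).card + (excedances x).card

theorem involutionWeight_one : involutionWeight (1 : Equiv.Perm (Fin n)) = 0 := by
  simp [involutionWeight, excedances]

/-- If both letters are fixed, one inversion and one two-cycle are created. Otherwise the
conjugation creates two inversions, one on each side, and only relabels the two-cycles. -/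
theorem involutionWeight_conjDemStep {x : Equiv.Perm (Fin n)} (hx : x⁻¹ = x) {i : Fin (n - 1)}
    (h : x (loLetter i) < x (hiLetter i)) :
    involutionWeight (conjDemStep x i) = involutionWeight x + 2 := by
  by_cases h' : x (loLetter i) = loLetter i ∧ x (hiLetter i) = hiLetter i
  · rw [conjDemStep_of_fixed hx h', involutionWeight, involutionWeight,
      card_inversions_mul_simpleRefl h]
    have : excedances (x * simpleRefl i) = insert (loLetter i) (excedances x) := by
      ext a
      simp only [mem_excedances, Finset.mem_insert, Equiv.Perm.mul_apply]
      by_cases h1 : a = loLetter i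
      · subst h1; simp [h'.2, loLetter_lt_hiLetter]
      by_cases h2 : a = hiLetter i
      · subst h2; simp [h'.1, h'.2, (loLetter_lt_hiLetter i).not_gt, (loLetter_lt_hiLetter i).ne']
      · rw [simpleRefl_of_ne h1 h2]; simp [h1]
    rw [this, Finset.card_insert_of_notMem (by simp [mem_excedances, h'.1])]
    omega
  · have h1 : (simpleRefl i * x) (loLetter i) < (simpleRefl i * x) (hiLetter i) :=
      (simpleRefl_lt h).resolve_right h'
    rw [conjDemStep_of_lt hx h h', involutionWeight, involutionWeight,
      card_inversions_mul_simpleRefl h1, ← card_inversions_inv (simpleRefl i * x), mul_inv_rev, hx,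
      simpleRefl_inv, card_inversions_mul_simpleRefl h]
    have : excedances (simpleRefl i * x * simpleRefl i) =
        (excedances x).map (simpleRefl i).toEmbedding := by
      ext a
      have hs : Equiv.symm (simpleRefl i) = simpleRefl i := simpleRefl_inv i
      simp only [mem_excedances, Finset.mem_map_equiv, hs, Equiv.Perm.mul_apply]
      obtain ⟨b, rfl⟩ := (simpleRefl i).surjective a
      rw [simpleRefl_simpleRefl]
      constructor
      · intro h2
        rcases lt_of_simpleRefl_lt h2 with h3 | ⟨rfl, h3⟩
        · exact h3
        · have h4 : x (loLetter i) = hiLetter i := by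
            rw [← h3, ← Equiv.Perm.inv_eq_iff_eq.1 (DFunLike.congr_fun hx _)]
          rw [h3, h4] at h
          exact absurd h (loLetter_lt_hiLetter i).not_gt
      · intro h2
        rcases simpleRefl_lt (i := i) h2 with h3 | ⟨rfl, h3⟩
        · exact h3
        · have h4 : x (hiLetter i) = loLetter i := by
            rw [← h3, ← Equiv.Perm.inv_eq_iff_eq.1 (DFunLike.congr_fun hx _)]
          rw [h3, h4] at h
          exact absurd h (loLetter_lt_hiLetter i).not_gt
    rw [this, Finset.card_map]
    omega

theorem involutionWeight_foldl_le (l : List (Fin (n - 1))) :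
    involutionWeight (l.foldl conjDemStep 1) ≤ 2 * l.length := by
  induction l using List.reverseRecOn with
  | nil => simp [involutionWeight_one]
  | append_singleton l i ih =>
    have hx := foldl_conjDemStep_inv l
    rw [List.foldl_append, List.foldl_cons, List.foldl_nil, List.length_append,
      List.length_singleton]
    rcases mul_simpleRefl_lt_or_gt (l.foldl conjDemStep 1) i with h | h
    · rw [involutionWeight_conjDemStep hx h]; omega
    · rw [conjDemStep_of_gt hx h]; omega

end Involution

/-! ### The cycle description of atoms -/

/-- The conditions, on the positions `w v` of the letters `v`, which describe the atoms `w` of an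
involution `x`: the larger letter of a two-cycle comes first, no letter between the two in value
comes between them in position, and cycles `a ≤ x a` and `c ≤ x c` with `a < c` and `x a < x c` have
`a` before `x c`. -/
structure AtomLike {n : ℕ} (x w : Equiv.Perm (Fin n)) : Prop where
  desc : ∀ a, a < x a → w (x a) < w a
  gap : ∀ a e, a < e → e < x a → w (x a) < w e → w a < w e
  sep : ∀ a c, a ≤ x a → c ≤ x c → a < c → x a < x c → w a < w (x c)

section AtomLike

variable {n : ℕ}

theorem apply_apply_of_inv_eq {x : Equiv.Perm (Fin n)} (hx : x⁻¹ = x) (a : Fin n) :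
    x (x a) = a := by
  have := Equiv.Perm.inv_eq_iff_eq.1 (DFunLike.congr_fun hx a)
  exact this.symm

/-- If the cycle of `a` is below the cycle of `c` in both endpoints, then `a` comes before `c`. -/
theorem AtomLike.lt_of_cycle_lt {x w : Equiv.Perm (Fin n)} (hx : x⁻¹ = x) (h : AtomLike x w)
    {a c : Fin n} (h1 : a < c ∨ x a < c) (h2 : a < x c ∨ x a < x c) (h3 : a < c ∨ a < x c)
    (h4 : x a < c ∨ x a < x c) : w a < w c := by
  have ha := apply_apply_of_inv_eq hx a
  have hc := apply_apply_of_inv_eq hx c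
  have d1 := h.desc (x a)
  have d2 := h.desc c
  rw [ha] at d1
  -- The four disjunctions say that the cycle of `a` has the smaller minimum and the smaller
  -- maximum. By `desc` the minimum comes last in its cycle and the maximum first, so `sep`, applied
  -- to the two minima, separates the whole cycles.
  rcases le_or_gt a (x a) with ha' | ha' <;> rcases le_or_gt c (x c) with hc' | hc'
  · have := h.sep a c
    grind
  · have := h.sep a (x c)
    grind
  · have := h.sep (x a) c
    grind
  · have := h.sep (x a) (x c)
    grind

theorem atomLike_one : AtomLike (1 : Equiv.Perm (Fin n)) 1 where
  desc _ h := absurd h (lt_irrefl _)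
  gap _ _ h h' := absurd (h.trans h') (lt_irrefl _)
  sep _ _ _ _ h _ := h

theorem AtomLike.eq_one {x : Equiv.Perm (Fin n)} (hx : x⁻¹ = x) (h : AtomLike x 1) : x = 1 := by
  have key : ∀ a, x a ≤ a := fun a => not_lt.1 fun h1 => (h.desc a h1).not_gt h1
  refine Equiv.ext fun a => le_antisymm (key a) ?_
  simpa [apply_apply_of_inv_eq hx] using key (x a)

/-- The cycles of two neighbouring letters at an ascent of `x` are comparable in both endpoints. In
contrapositive form, every descent of `w` is a descent of `x`, which allows reduced words to be
peeled from the right. -/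
theorem AtomLike.ascent {x w : Equiv.Perm (Fin n)} (hx : x⁻¹ = x) (h : AtomLike x w)
    {i : Fin (n - 1)} (hi : x (loLetter i) < x (hiLetter i)) : w (loLetter i) < w (hiLetter i) := by
  have := loLetter_lt_hiLetter i
  exact h.lt_of_cycle_lt hx (Or.inl this) (Or.inr hi) (Or.inl this) (Or.inr hi)

/-- No value lies strictly between the two letters, so `gap` is vacuous for the new cycle, and any
other cycle compares with both letters in the same way. -/
theorem AtomLike.mul_of_fixed {x w : Equiv.Perm (Fin n)} (hx : x⁻¹ = x) (h : AtomLike x w)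
    {i : Fin (n - 1)} (hi : x (loLetter i) = loLetter i ∧ x (hiLetter i) = hiLetter i) :
    AtomLike (x * simpleRefl i) (w * simpleRefl i) := by
  have hlt := loLetter_lt_hiLetter i
  have hw := h.ascent hx (i := i) (by rwa [hi.1, hi.2])
  have k1 : ∀ p, p < hiLetter i → p ≤ loLetter i := fun p => le_loLetter_of_lt_hiLetter
  have k2 : ∀ p, loLetter i < p → hiLetter i ≤ p := fun p => hiLetter_le_of_loLetter_lt
  have s1 := simpleRefl_loLetter i
  have s2 := simpleRefl_hiLetter i
  have s3 := fun p => @simpleRefl_of_ne n i p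
  have inj := x.injective
  obtain ⟨hi1, hi2⟩ := hi
  constructor
  · intro a ha
    have := h.desc a
    simp only [Equiv.Perm.mul_apply] at *
    have := @inj a (loLetter i)
    have := @inj a (hiLetter i)
    grind
  · intro a e
    have := h.gap a e
    have := h.gap a (loLetter i)
    have := h.gap a (hiLetter i)
    have := @inj a (loLetter i)
    have := @inj a (hiLetter i)
    simp only [Equiv.Perm.mul_apply] at *
    grind
  · intro a c
    have := h.sep a c
    have := h.sep a (loLetter i)
    have := h.sep a (hiLetter i)
    have := h.sep (loLetter i) c
    have := h.sep (hiLetter i) c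
    have := @inj a (loLetter i)
    have := @inj a (hiLetter i)
    have := @inj c (loLetter i)
    have := @inj c (hiLetter i)
    simp only [Equiv.Perm.mul_apply] at *
    grind

theorem AtomLike.mul_of_cycle {x w : Equiv.Perm (Fin n)} (hx : x⁻¹ = x) (h : AtomLike x w)
    {i : Fin (n - 1)} (hi : x (loLetter i) = hiLetter i) :
    AtomLike (x * simpleRefl i) (w * simpleRefl i) := by
  have hlt := loLetter_lt_hiLetter i
  have hi' : x (hiLetter i) = loLetter i := by rw [← hi, apply_apply_of_inv_eq hx]
  have hw := h.desc (loLetter i) (by rwa [hi])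
  rw [hi] at hw
  have k1 : ∀ p, p < hiLetter i → p ≤ loLetter i := fun p => le_loLetter_of_lt_hiLetter
  have k2 : ∀ p, loLetter i < p → hiLetter i ≤ p := fun p => hiLetter_le_of_loLetter_lt
  have s1 := simpleRefl_loLetter i
  have s2 := simpleRefl_hiLetter i
  have s3 := fun p => @simpleRefl_of_ne n i p
  have inj := x.injective
  constructor
  · intro a ha
    have := h.desc a
    simp only [Equiv.Perm.mul_apply] at *
    have := @inj a (loLetter i)
    have := @inj a (hiLetter i)
    grind
  · intro a e
    have := h.gap a e
    have := h.gap a (loLetter i)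
    have := h.gap a (hiLetter i)
    have := @inj a (loLetter i)
    have := @inj a (hiLetter i)
    simp only [Equiv.Perm.mul_apply] at *
    grind
  · intro a c
    have := h.sep a c
    have := h.sep a (loLetter i)
    have := h.sep a (hiLetter i)
    have := h.sep (loLetter i) c
    have := h.sep (hiLetter i) c
    have := @inj a (loLetter i)
    have := @inj a (hiLetter i)
    have := @inj c (loLetter i)
    have := @inj c (hiLetter i)
    simp only [Equiv.Perm.mul_apply] at *
    grind

/-- Relabelling changes only the comparison of the two neighbouring letters. The new instances of
`gap` follow because the cycle of `loLetter i` precedes that of `hiLetter i`. -/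
theorem AtomLike.conj_of_ascent {x w : Equiv.Perm (Fin n)} (hx : x⁻¹ = x) (h : AtomLike x w)
    {i : Fin (n - 1)} (hi : x (loLetter i) < x (hiLetter i))
    (hi' : ¬ (x (loLetter i) = loLetter i ∧ x (hiLetter i) = hiLetter i)) :
    AtomLike (simpleRefl i * x * simpleRefl i) (w * simpleRefl i) := by
  have hlt := loLetter_lt_hiLetter i
  have hw := h.ascent hx hi
  have xx := apply_apply_of_inv_eq hx
  constructor
  · intro a ha
    obtain ⟨a, rfl⟩ := (simpleRefl i).surjective a
    simp only [Equiv.Perm.mul_apply, simpleRefl_simpleRefl] at *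
    rcases lt_of_simpleRefl_lt ha with h1 | ⟨rfl, h1⟩
    · exact h.desc a h1
    · have := xx (hiLetter i); grind
  · intro a e ha he hwe
    obtain ⟨a, rfl⟩ := (simpleRefl i).surjective a
    obtain ⟨e, rfl⟩ := (simpleRefl i).surjective e
    simp only [Equiv.Perm.mul_apply, simpleRefl_simpleRefl] at *
    rcases lt_of_simpleRefl_lt ha with h1 | ⟨h1, h1'⟩ <;>
      rcases lt_of_simpleRefl_lt he with h2 | ⟨h2, h2'⟩
    · exact h.gap a e h1 h2 hwe
    · have e1 := xx a
      rw [h2'] at e1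
      subst h2
      rw [← e1]
      exact h.lt_of_cycle_lt hx (Or.inr (by rwa [xx])) (Or.inl hi) (Or.inl (e1 ▸ h1))
        (Or.inl (by rwa [xx]))
    · subst h1 h1'
      exact absurd hwe (h.lt_of_cycle_lt hx (Or.inr hi) (Or.inl (by rwa [xx]))
        (Or.inr (by rwa [xx])) (Or.inl hi)).not_gt
    · grind
  · intro a c ha hc hac hxac
    obtain ⟨a, rfl⟩ := (simpleRefl i).surjective a
    obtain ⟨c, rfl⟩ := (simpleRefl i).surjective c
    simp only [Equiv.Perm.mul_apply, simpleRefl_simpleRefl] at *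
    have ha := le_of_simpleRefl_le ha
    have hc := le_of_simpleRefl_le hc
    have hac := lt_of_simpleRefl_lt hac
    have hxac := lt_of_simpleRefl_lt hxac
    have := h.sep a c
    grind

/-- The descent of `w` settles the instances of `gap` whose letters are interchanged. Nested cycles
that become comparable need a new instance of `sep`; it comes from `gap` for `x` together with that
descent. -/
theorem AtomLike.conj_of_descent {x w : Equiv.Perm (Fin n)} (hx : x⁻¹ = x) (h : AtomLike x w)
    {i : Fin (n - 1)} (hi : x (loLetter i) ≠ hiLetter i) (hw : w (hiLetter i) < w (loLetter i)) :
    AtomLike (simpleRefl i * x * simpleRefl i) (w * simpleRefl i) := by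
  have hlt := loLetter_lt_hiLetter i
  have xx := apply_apply_of_inv_eq hx
  constructor
  · intro a ha
    obtain ⟨a, rfl⟩ := (simpleRefl i).surjective a
    simp only [Equiv.Perm.mul_apply, simpleRefl_simpleRefl] at *
    rcases lt_of_simpleRefl_lt ha with h1 | ⟨rfl, h1⟩
    · exact h.desc a h1
    · have := xx (hiLetter i); grind
  · intro a e ha he hwe
    obtain ⟨a, rfl⟩ := (simpleRefl i).surjective a
    obtain ⟨e, rfl⟩ := (simpleRefl i).surjective e
    simp only [Equiv.Perm.mul_apply, simpleRefl_simpleRefl] at *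
    rcases lt_of_simpleRefl_lt ha with h1 | ⟨h1, h1'⟩ <;>
      rcases lt_of_simpleRefl_lt he with h2 | ⟨h2, h2'⟩
    · exact h.gap a e h1 h2 hwe
    · rw [h2', h2] at hwe
      exact absurd hwe hw.not_gt
    · rwa [h1, h1']
    · grind
  · intro a c ha hc hac hxac
    obtain ⟨a, rfl⟩ := (simpleRefl i).surjective a
    obtain ⟨c, rfl⟩ := (simpleRefl i).surjective c
    simp only [Equiv.Perm.mul_apply, simpleRefl_simpleRefl] at *
    have ha := le_of_simpleRefl_le ha
    have hc := le_of_simpleRefl_le hc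
    have hac := lt_of_simpleRefl_lt hac
    have hxac := lt_of_simpleRefl_lt hxac
    have := h.sep a c
    have := xx a
    have := xx c
    have := h.gap a (loLetter i)
    have := h.gap c (hiLetter i)
    have := w.injective.ne (a₁ := hiLetter i) (a₂ := x (loLetter i))
    grind

end AtomLike

/-! ### Atoms are the permutations satisfying the cycle conditions -/

section Characterization

variable {n : ℕ}

theorem AtomLike.conjDemStep {y w : Equiv.Perm (Fin n)} (hy : y⁻¹ = y) (h : AtomLike y w)
    {i : Fin (n - 1)} (hi : y (loLetter i) < y (hiLetter i)) :
    AtomLike (conjDemStep y i) (w * simpleRefl i) := by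
  by_cases h' : y (loLetter i) = loLetter i ∧ y (hiLetter i) = hiLetter i
  · rw [conjDemStep_of_fixed hy h']
    exact h.mul_of_fixed hy h'
  · rw [conjDemStep_of_lt hy hi h']
    exact h.conj_of_ascent hy hi h'

/-- An involution with a descent at `i` is of the form `s ∘ y ∘ s` for an involution `y` with an
ascent at `i`, and the cycle conditions descend to `y`. -/
theorem exists_conjDemStep_eq {x : Equiv.Perm (Fin n)} (hx : x⁻¹ = x) {i : Fin (n - 1)}
    (hi : x (hiLetter i) < x (loLetter i)) :
    ∃ y : Equiv.Perm (Fin n), y⁻¹ = y ∧ y (loLetter i) < y (hiLetter i) ∧ conjDemStep y i = x ∧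
      ∀ w, AtomLike x w → w (hiLetter i) < w (loLetter i) → AtomLike y (w * simpleRefl i) := by
  by_cases h : x (loLetter i) = hiLetter i
  · have h' : x (hiLetter i) = loLetter i := by rw [← h, apply_apply_of_inv_eq hx]
    have e := Equiv.mul_swap_eq_swap_mul x (loLetter i) (hiLetter i)
    rw [h, h', Equiv.swap_comm (hiLetter i)] at e
    have hy : (x * simpleRefl i)⁻¹ = x * simpleRefl i := by
      rw [mul_inv_rev, hx, simpleRefl_inv]; exact e.symm
    refine ⟨x * simpleRefl i, hy, by simpa using hi, ?_, fun w hw _ => hw.mul_of_cycle hx h⟩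
    rw [conjDemStep_of_fixed hy (by simp [h, h']), mul_assoc, simpleRefl_mul_self, mul_one]
  · have hy : (simpleRefl i * x * simpleRefl i)⁻¹ = simpleRefl i * x * simpleRefl i := by
      rw [mul_inv_rev, mul_inv_rev, hx, simpleRefl_inv, mul_assoc]
    have hlt : (simpleRefl i * x * simpleRefl i) (loLetter i) <
        (simpleRefl i * x * simpleRefl i) (hiLetter i) := by
      simpa using (simpleRefl_lt (i := i) hi).resolve_right fun h' => h h'.2
    refine ⟨simpleRefl i * x * simpleRefl i, hy, hlt, ?_, fun w hw h' => hw.conj_of_descent hx h h'⟩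
    rw [conjDemStep_of_lt hy hlt]
    · simp only [← mul_assoc, simpleRefl_mul_self, one_mul]
      rw [mul_assoc, simpleRefl_mul_self, mul_one]
    · rintro ⟨h1, h2⟩
      simp only [Equiv.Perm.mul_apply, simpleRefl_loLetter, simpleRefl_hiLetter,
        simpleRefl_eq_iff] at h1 h2
      rw [h1, h2] at hi
      exact hi.not_gt (loLetter_lt_hiLetter i)

theorem exists_atomLike {x : Equiv.Perm (Fin n)} (hx : x⁻¹ = x) : ∃ w, AtomLike x w := by
  induction hk : involutionWeight x using Nat.strong_induction_on generalizing x with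
  | _ k ih =>
    by_cases h1 : x = 1
    · exact ⟨1, h1 ▸ atomLike_one⟩
    obtain ⟨i, hi⟩ := exists_descent h1
    obtain ⟨y, hy, hlt, rfl, -⟩ := exists_conjDemStep_eq hx hi
    obtain ⟨w, hw⟩ := ih _ (by rw [← hk, involutionWeight_conjDemStep hy hlt]; omega) hy rfl
    exact ⟨_, hw.conjDemStep hy hlt⟩

/-- The last letter of a reduced word is a descent of `w`, hence of `x`; undoing it lowers the
weight by 2 and keeps the conditions, down to the identity. -/
theorem AtomLike.foldl_conjDemStep {x w : Equiv.Perm (Fin n)} (hx : x⁻¹ = x) (h : AtomLike x w)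
    {l : List (Fin (n - 1))} (hl : IsReducedWord l w) :
    l.foldl _root_.conjDemStep 1 = x ∧ involutionWeight x = 2 * l.length := by
  induction l using List.reverseRecOn generalizing x w with
  | nil =>
    obtain rfl : 1 = w := by simpa [wordProd] using hl.1
    rw [h.eq_one hx]
    exact ⟨rfl, involutionWeight_one⟩
  | append_singleton l i ih =>
    obtain ⟨h1, h2⟩ := hl.of_concat
    have hi : x (hiLetter i) < x (loLetter i) :=
      (mul_simpleRefl_lt_or_gt x i).resolve_left fun h3 => (h.ascent hx h3).not_gt h1
    obtain ⟨y, hy, hlt, rfl, hd⟩ := exists_conjDemStep_eq hx hi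
    obtain ⟨h3, h4⟩ := ih hy (hd w h h1) h2
    rw [List.foldl_append, h3, List.foldl_cons, List.foldl_nil,
      involutionWeight_conjDemStep hy hlt, h4, List.length_append, List.length_singleton]
    exact ⟨rfl, by ring⟩

/-- Each step adds at most 2 to the weight, so equality forces every step to be an ascent, and
ascents preserve the conditions. -/
theorem atomLike_of_foldl_conjDemStep {l : List (Fin (n - 1))}
    (h : involutionWeight (l.foldl conjDemStep 1) = 2 * l.length) :
    AtomLike (l.foldl conjDemStep 1) (wordProd l) := by
  induction l using List.reverseRecOn with
  | nil => exact atomLike_one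
  | append_singleton l i ih =>
    have hy := foldl_conjDemStep_inv l
    have hle := involutionWeight_foldl_le l
    rw [List.foldl_append, List.foldl_cons, List.foldl_nil, List.length_append,
      List.length_singleton] at h
    rw [List.foldl_append, List.foldl_cons, List.foldl_nil, wordProd_concat]
    rcases mul_simpleRefl_lt_or_gt (l.foldl conjDemStep 1) i with hi | hi
    · rw [involutionWeight_conjDemStep hy hi] at h
      exact (ih (by omega)).conjDemStep hy hi
    · rw [conjDemStep_of_gt hy hi] at h
      omega

/-- The atoms of an involution are the permutations satisfying the cycle conditions. -/
theorem mem_involutionAtoms_iff {x : Equiv.Perm (Fin n)} (hx : x⁻¹ = x) (w : Equiv.Perm (Fin n)) :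
    w ∈ involutionAtoms x ↔ AtomLike x w := by
  have hlow : ∀ v ∈ heckeAtoms 1 x, involutionWeight x ≤ 2 * coxLength v := by
    intro v hv
    obtain ⟨l, hl, hl'⟩ := exists_demAct_one_eq v
    have := involutionWeight_foldl_le l
    rwa [← hl', show demAct 1 v = x from hv, hl.2] at this
  have hatom : ∀ v, AtomLike x v → v ∈ heckeAtoms 1 x ∧ involutionWeight x = 2 * coxLength v := by
    intro v hv
    obtain ⟨l, hl, hl'⟩ := exists_demAct_one_eq v
    obtain ⟨h1, h2⟩ := hv.foldl_conjDemStep hx hl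
    exact ⟨hl'.trans h1, by rw [h2, hl.2]⟩
  constructor
  · rintro ⟨h1, h2⟩
    -- Some permutation attains the lower bound `hlow`, so an element of minimal length attains it
    -- too.
    obtain ⟨v, hv⟩ := exists_atomLike hx
    obtain ⟨h3, h4⟩ := hatom v hv
    have h5 := h2 v h3
    have h6 := hlow w h1
    obtain ⟨l, hl, hl'⟩ := exists_demAct_one_eq w
    have h7 : l.foldl conjDemStep 1 = x := hl'.symm.trans h1
    have := atomLike_of_foldl_conjDemStep (l := l) (by rw [h7, hl.2]; omega)
    rwa [h7, hl.1] at this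
  · intro h
    obtain ⟨h1, h2⟩ := hatom w h
    refine ⟨h1, fun v hv => ?_⟩
    have := hlow v hv
    omega

end Characterization

/-! ### The moves between atoms -/

section Moves

variable {n : ℕ}

/-- Letters `a < c` with `c` immediately before `a` form a cycle. -/
theorem AtomLike.apply_eq_of_adjacent {x w : Equiv.Perm (Fin n)} (hx : x⁻¹ = x) (h : AtomLike x w)
    {a c : Fin n} (hac : a < c) (hw : (w a : ℕ) = w c + 1) : x a = c := by
  by_contra hne
  have hne' : x c ≠ a := fun e => hne (by rw [← e, apply_apply_of_inv_eq hx])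
  have hlt : w c < w a := by rw [Fin.lt_def]; omega
  have hadj : ∀ p, w c < p → p < w a → False := fun p h1 h2 => by
    rw [Fin.lt_def] at h1 h2; omega
  -- If one cycle has an endpoint beyond the other letter, `gap` and `desc` put `x a` or `x c`
  -- strictly between two adjacent positions. Otherwise the cycle of `a` is the lower one, and `a`
  -- would precede `c`.
  by_cases h1 : c < x a
  · have h2 := h.desc a (hac.trans h1)
    have h3 := h.gap a c hac h1
    have h4 := w.injective.ne h1.ne
    grind
  by_cases h2 : x c < a
  · have h3 := h.gap (x c) a h2
    have h4 := h.desc (x c)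
    rw [apply_apply_of_inv_eq hx] at h3 h4
    have h5 := w.injective.ne hne'
    grind
  have h3 : x a < c := lt_of_le_of_ne (not_lt.1 h1) hne
  have h4 : a < x c := lt_of_le_of_ne (not_lt.1 h2) (Ne.symm hne')
  exact absurd hlt (h.lt_of_cycle_lt hx (Or.inl hac) (Or.inl h4) (Or.inl hac) (Or.inl h3)).not_gt

/-- `w'` arises from `w` by rearranging three letters `a < b < c` in consecutive positions, from
`c, a, b` to `b, c, a`. -/
structure AtomMove (w w' : Equiv.Perm (Fin n)) (a b c : Fin n) : Prop where
  lt_ab : a < b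
  lt_bc : b < c
  pos_a : (w a : ℕ) = w c + 1
  pos_b : (w b : ℕ) = w c + 2
  pos_b' : w' b = w c
  pos_c' : w' c = w a
  pos_a' : w' a = w b
  pos_of_ne : ∀ p, p ≠ a → p ≠ b → p ≠ c → w' p = w p

/-- Moving a letter `b` across an adjacent pair `c, a` which forms a cycle, where `a < b < c`,
preserves the cycle conditions. -/
theorem AtomLike.of_block {x w w' : Equiv.Perm (Fin n)} (hx : x⁻¹ = x) (h : AtomLike x w)
    {a b c : Fin n} (hab : a < b) (hbc : b < c) (hac : x a = c)
    (hw : ∀ p, p ≠ a → p ≠ b → p ≠ c →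
      (w p < w a ∧ w p < w b ∧ w p < w c) ∨ (w a < w p ∧ w b < w p ∧ w c < w p))
    (hw' : ∀ p, p ≠ a → p ≠ b → p ≠ c →
      (w' p < w' a ∧ w' p < w' b ∧ w' p < w' c) ∨ (w' a < w' p ∧ w' b < w' p ∧ w' c < w' p))
    (heq : ∀ p, p ≠ a → p ≠ b → p ≠ c → (w' p = w p ∧ (w p < w a ↔ w' p < w' a)))
    (hca : w' c < w' a) (hb : ¬ (w' c < w' b ∧ w' b < w' a)) : AtomLike x w' := by
  have hca' : x c = a := by rw [← hac, apply_apply_of_inv_eq hx]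
  have inj := fun p q => @Equiv.injective _ _ x p q
  constructor
  · intro p hp
    have := h.desc p hp
    have := inj p a
    have := inj p c
    grind
  · intro p e hp he hwe
    have h0 := h.gap p e hp he
    have h1 := inj p a
    have h2 := inj p c
    -- If `c` lies between `b` and `x b`, then `sep a b` puts `x b` after the block; if `a` lies
    -- between `p` and `x p = b`, then `sep p a` puts `p` before it.
    have h3 := h.sep a b
    have h4 := h.sep p a
    have h5 := w'.injective.ne hab.ne
    by_cases pa : p = a
    · grind
    by_cases pc : p = c
    · grind
    by_cases pb : p = b
    · have := heq (x p)
      have := hw (x p)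
      have := hw' (x p)
      grind
    by_cases xb : x p = b
    · have := heq p pa pb pc
      have := hw p pa pb pc
      have := hw' p pa pb pc
      grind
    · have := heq p pa pb pc
      have := hw p pa pb pc
      have := hw' p pa pb pc
      have := heq (x p)
      have := hw (x p)
      have := hw' (x p)
      have := heq e
      have := hw e
      have := hw' e
      grind
  · intro p q hp hq hpq hxpq
    have h0 := h.sep p q hp hq hpq hxpq
    have h1 := inj p a
    have h2 := inj p c
    have h3 := inj q a
    have h4 := inj q c
    have := heq p
    have := hw p
    have := hw' p
    have := heq (x q)
    have := hw (x q)
    have := hw' (x q)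
    grind

theorem AtomMove.block {w w' : Equiv.Perm (Fin n)} {a b c : Fin n} (m : AtomMove w w' a b c)
    {p : Fin n} (pa : p ≠ a) (pb : p ≠ b) (pc : p ≠ c) :
    w' p = w p ∧ ((w p < w a ∧ w p < w b ∧ w p < w c) ∨
      (w a < w p ∧ w b < w p ∧ w c < w p)) := by
  obtain ⟨-, -, p1, p2, -, -, -, q4⟩ := m
  refine ⟨q4 p pa pb pc, ?_⟩
  have h1 := w.injective.ne pa
  have h2 := w.injective.ne pb
  have h3 := w.injective.ne pc
  simp only [Fin.lt_def, ne_eq, Fin.ext_iff] at *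
  omega

theorem AtomMove.atomLike {x w w' : Equiv.Perm (Fin n)} {a b c : Fin n} (hx : x⁻¹ = x)
    (m : AtomMove w w' a b c) (h : AtomLike x w) : AtomLike x w' := by
  have hac := h.apply_eq_of_adjacent hx (m.lt_ab.trans m.lt_bc) m.pos_a
  have q1 := m.pos_b'
  have q2 := m.pos_c'
  have q3 := m.pos_a'
  have p1 := m.pos_a
  have p2 := m.pos_b
  refine h.of_block hx m.lt_ab m.lt_bc hac (fun p pa pb pc => (m.block pa pb pc).2) ?_ ?_ ?_ ?_
  · intro p pa pb pc
    have := m.block pa pb pc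
    rw [q1, q2, q3, this.1]
    exact this.2.imp (fun h => ⟨h.2.1, h.2.2, h.1⟩) fun h => ⟨h.2.1, h.2.2, h.1⟩
  · intro p pa pb pc
    have := m.block pa pb pc
    rw [q3, this.1]
    exact ⟨rfl, by grind⟩
  · rw [q2, q3, Fin.lt_def]; omega
  · rw [q1, q2, q3, Fin.lt_def, Fin.lt_def]; omega

theorem AtomMove.atomLike_symm {x w w' : Equiv.Perm (Fin n)} {a b c : Fin n} (hx : x⁻¹ = x)
    (m : AtomMove w w' a b c) (h : AtomLike x w') : AtomLike x w := by
  have q1 := m.pos_b'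
  have q2 := m.pos_c'
  have q3 := m.pos_a'
  have p1 := m.pos_a
  have p2 := m.pos_b
  have hac := h.apply_eq_of_adjacent hx (m.lt_ab.trans m.lt_bc) (by rw [q3, q2]; omega)
  refine h.of_block hx m.lt_ab m.lt_bc hac ?_ (fun p pa pb pc => (m.block pa pb pc).2) ?_ ?_ ?_
  · intro p pa pb pc
    have := m.block pa pb pc
    rw [q1, q2, q3, this.1]
    exact this.2.imp (fun h => ⟨h.2.1, h.2.2, h.1⟩) fun h => ⟨h.2.1, h.2.2, h.1⟩
  · intro p pa pb pc
    have := m.block pa pb pc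
    rw [q3, this.1]
    exact ⟨rfl, by grind⟩
  · rw [Fin.lt_def]; omega
  · rw [Fin.lt_def, Fin.lt_def]; omega

/-- A move adds exactly one element to the inversion set. -/
theorem AtomMove.card_atomInv {x u v : Equiv.Perm (Fin n)} {a b c : Fin n} (hx : x⁻¹ = x)
    (m : AtomMove u⁻¹ v⁻¹ a b c) (h : AtomLike x u⁻¹) :
    (atomInv v x).card = (atomInv u x).card + 1 := by
  have hac := h.apply_eq_of_adjacent hx (m.lt_ab.trans m.lt_bc) m.pos_a
  have hca : x c = a := by rw [← hac, apply_apply_of_inv_eq hx]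
  have q1 := m.pos_b'
  have q2 := m.pos_c'
  have q3 := m.pos_a'
  have p1 := m.pos_a
  have p2 := m.pos_b
  have hab := m.lt_ab
  have hbc := m.lt_bc
  have p3 : u⁻¹ c < u⁻¹ a := by rw [Fin.lt_def]; omega
  have p4 : u⁻¹ a < u⁻¹ b := by rw [Fin.lt_def]; omega
  have blk := fun p => m.block (p := p)
  -- Only `b` changes order, with `a` and with `c`. It is comparable in `pairSet x` with `a` if it
  -- is in `leftSet x`, and with `c` if it is in `rightSet x`.
  have key : ∃ r, r ∉ atomInv u x ∧ atomInv v x = insert r (atomInv u x) := by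
    rcases le_or_gt b (x b) with hb | hb
    · refine ⟨(b, a), ?_, ?_⟩
      · rw [atomInv, Finset.mem_filter]; exact fun h => h.2.not_gt p4
      · ext ⟨p, q⟩
        have := blk p
        have := blk q
        simp only [atomInv, pairSet, leftSet, rightSet, Finset.mem_filter, Finset.mem_union,
          Finset.mem_product, Finset.mem_univ, true_and, Finset.mem_insert, Prod.mk.injEq]
        grind
    · refine ⟨(b, c), ?_, ?_⟩
      · rw [atomInv, Finset.mem_filter]; exact fun h => h.2.not_gt (p3.trans p4)
      · ext ⟨p, q⟩
        have := blk p
        have := blk q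
        simp only [atomInv, pairSet, leftSet, rightSet, Finset.mem_filter, Finset.mem_union,
          Finset.mem_product, Finset.mem_univ, true_and, Finset.mem_insert, Prod.mk.injEq]
        grind
  obtain ⟨r, hr, hr'⟩ := key
  rw [hr', Finset.card_insert_of_notMem hr]

end Moves

/-! ### Uniqueness of the extremal atoms -/

section Extremal

variable {n : ℕ}

/-- No three letters `a < b < c` stand in consecutive positions in the order `b, c, a`. -/
def AvoidsBCA (w : Equiv.Perm (Fin n)) : Prop :=
  ∀ a b c, a < b → b < c → (w c : ℕ) = w b + 1 → (w a : ℕ) = w c + 1 → False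

/-- No three letters `a < b < c` stand in consecutive positions in the order `c, a, b`. -/
def AvoidsCAB (w : Equiv.Perm (Fin n)) : Prop :=
  ∀ a b c, a < b → b < c → (w a : ℕ) = w c + 1 → (w b : ℕ) = w a + 1 → False

theorem exists_letter_at (w : Equiv.Perm (Fin n)) {k : ℕ} (hk : k < n) : ∃ p, (w p : ℕ) = k := by
  obtain ⟨p, hp⟩ := w.surjective ⟨k, hk⟩
  exact ⟨p, by rw [hp]⟩

/-- If the cycle were not adjacent, every letter after `x a` up to and including `a` would exceed `x
a`, which is absurd for `a` itself. At a first exception `p`, the preceding letter `f` exceeds `x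
a`, so `x p = f`. The letter `e` before `f` is at least `x a`. Then `e < f` gives the forbidden
pattern `e, f, p`, while `e > f` makes `e` a second partner of `f`. -/
theorem AtomLike.adjacent {x w : Equiv.Perm (Fin n)} (hx : x⁻¹ = x) (h : AtomLike x w)
    (hno : AvoidsBCA w) {a : Fin n} (ha : a < x a) : (w a : ℕ) = w (x a) + 1 := by
  by_contra hne
  have xx := apply_apply_of_inv_eq hx
  have key : ∀ k p, (w p : ℕ) = k → w (x a) < w p → w p ≤ w a → x a < p := by
    intro k
    induction k using Nat.strong_induction_on with
    | _ k ih =>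
      intro p hk h1 h2
      by_contra hp
      have hpc : p < x a := lt_of_le_of_ne (not_lt.1 hp) fun e => by simp [e] at h1
      obtain ⟨f, hf⟩ := exists_letter_at w (k := k - 1) (by omega)
      have hpa : p ≤ a := by
        by_contra h3
        exact (h.gap a p (not_le.1 h3) hpc h1).not_ge h2
      have hfp : p < f → x p = f := fun h3 => h.apply_eq_of_adjacent hx h3 (by
        rw [Fin.lt_def] at h1; omega)
      by_cases hfc : f = x a
      · subst hfc
        have := x.injective (hfp hpc)
        subst this
        rw [Fin.lt_def] at h1
        omega
      have hwf : w (x a) < w f := by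
        have := w.injective.ne hfc
        simp only [Fin.lt_def, ne_eq, Fin.ext_iff] at *
        omega
      have hwf' : w f ≤ w a := by
        simp only [Fin.lt_def, Fin.le_def] at *
        omega
      have hcf := ih (k - 1) (by rw [Fin.lt_def] at h1; omega) f hf hwf hwf'
      have hxp := hfp (hpc.trans hcf)
      obtain ⟨e, he⟩ := exists_letter_at w (k := k - 2) (by omega)
      have hce : x a ≤ e := by
        by_cases hec : e = x a
        · exact hec.ge
        · have := w.injective.ne hec
          refine (ih (k - 2) (by rw [Fin.lt_def] at h1; omega) e he ?_ ?_).le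
          · simp only [Fin.lt_def, ne_eq, Fin.ext_iff] at *
            omega
          · simp only [Fin.lt_def, Fin.le_def] at *
            omega
      rcases lt_trichotomy e f with h3 | h3 | h3
      · refine hno p e f (hpc.trans_le hce) h3 ?_ ?_ <;> rw [Fin.lt_def] at h1 hwf <;> omega
      · rw [h3] at he
        rw [Fin.lt_def] at h1 hwf
        omega
      · have h4 := h.apply_eq_of_adjacent hx h3 (by rw [Fin.lt_def] at h1 hwf; omega)
        rw [← hxp, xx] at h4
        exact absurd (hpc.trans_le hce) (by simp [h4])
  exact (key _ a rfl (h.desc a ha) le_rfl).not_gt ha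

/-- Walk right from `a`. If the next letter `d` is a cycle minimum or a fixed point, it exceeds `a`,
since a descent would make `a` the larger letter of a cycle. If not, `x d` follows `d` immediately,
and `x d < a` would give either the forbidden pattern `a, d, x d` or a wrong partner for `d`. -/
theorem AtomLike.lower_sorted {x w : Equiv.Perm (Fin n)} (hx : x⁻¹ = x) (h : AtomLike x w)
    (hno : AvoidsBCA w) {a a' : Fin n} (ha : a ≤ x a) (ha' : a' ≤ x a') (hw : w a < w a') :
    a < a' := by
  have xx := apply_apply_of_inv_eq hx
  induction hk : (w a' : ℕ) - w a using Nat.strong_induction_on generalizing a with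
  | _ k ih =>
    obtain ⟨d, hd⟩ := exists_letter_at w (k := w a + 1) (by rw [Fin.lt_def] at hw; omega)
    have hstep : ∀ e, e ≤ x e → a < e → w a < w e → w e ≤ w a' → a < a' := by
      intro e he hae h1 h2
      rcases h2.eq_or_lt with h3 | h3
      · rwa [← w.injective h3]
      · exact hae.trans (ih _ (by rw [Fin.lt_def] at h1 h3; omega) he h3 rfl)
    have hda : d ≠ a := by rintro rfl; omega
    have hxd : d < a → x d = a := fun h1 => h.apply_eq_of_adjacent hx h1 hd
    rcases le_or_gt d (x d) with h1 | h1
    · refine hstep d h1 ?_ (by rw [Fin.lt_def]; omega) (by rw [Fin.lt_def] at hw; rw [Fin.le_def]; omega)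
      refine lt_of_le_of_ne (not_lt.1 fun h2 => ?_) hda.symm
      rw [← hxd h2, xx] at ha
      exact (hxd h2 ▸ h2).not_ge ha
    · have h2 := h.adjacent hx hno (a := x d) (by rwa [xx])
      rw [xx] at h2
      have hd' : w d ≠ w a' := fun e => by rw [w.injective e] at h1; exact h1.not_ge ha'
      have h3 : a < x d := by
        refine lt_of_le_of_ne (not_lt.1 fun h3 => ?_) fun e => by rw [← e] at h2; omega
        rcases lt_or_gt_of_ne hda with h4 | h4
        · exact h3.ne (hxd h4)
        · exact hno _ _ _ h3 h4 hd h2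
      refine hstep (x d) (by rw [xx]; exact h1.le) h3 (by rw [Fin.lt_def]; omega) ?_
      simp only [ne_eq, Fin.ext_iff, Fin.lt_def, Fin.le_def] at *
      omega

theorem AtomLike.lt_of_min_lt {x w : Equiv.Perm (Fin n)} (hx : x⁻¹ = x) (h : AtomLike x w)
    (hno : AvoidsBCA w) {p q : Fin n}
    (hpq : min p (x p) < min q (x q) ∨ (min p (x p) = min q (x q) ∧ q < p)) : w p < w q := by
  have xx := apply_apply_of_inv_eq hx
  rcases hpq with hpq | ⟨hpq, hlt⟩
  -- Each letter is replaced by its cycle minimum, which stands at the same position or the next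
  -- one.
  · have low : ∀ r, ∃ s, s ≤ x s ∧ min r (x r) = s ∧ w r ≤ w s ∧ (w s : ℕ) ≤ w r + 1 ∧
        (r = s ∨ r = x s) := by
      intro r
      rcases le_or_gt r (x r) with h1 | h1
      · exact ⟨r, h1, min_eq_left h1, le_rfl, by omega, Or.inl rfl⟩
      · have h2 := h.adjacent hx hno (a := x r) (by rwa [xx])
        rw [xx] at h2
        refine ⟨x r, by rw [xx]; exact h1.le, min_eq_right h1.le, ?_, by omega,
          Or.inr (xx r).symm⟩
        rw [Fin.le_def]; omega
    obtain ⟨s, s1, s2, s3, s4, s5⟩ := low p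
    obtain ⟨t, t1, t2, t3, t4, t5⟩ := low q
    rw [s2, t2] at hpq
    have hst : w s < w t := lt_of_le_of_ne
      (not_lt.1 fun h1 => (h.lower_sorted hx hno t1 s1 h1).not_gt hpq) (w.injective.ne hpq.ne)
    have hne : w p ≠ w q := by
      intro e
      have := w.injective e
      subst this
      exact hpq.ne (s2.symm.trans t2)
    simp only [ne_eq, Fin.ext_iff, Fin.lt_def, Fin.le_def] at *
    omega
  · have h1 := h.desc q
    have h2 : x q = p := by
      have h5 := xx q
      have h6 := xx p
      have := @Equiv.injective _ _ x p q
      grind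
    rw [h2] at h1
    exact h1 hlt

theorem AtomLike.eq_of_avoidsBCA {x w w' : Equiv.Perm (Fin n)} (hx : x⁻¹ = x)
    (h : AtomLike x w) (hno : AvoidsBCA w) (h' : AtomLike x w') (hno' : AvoidsBCA w') :
    w = w' := by
  -- Both permutations sort the letters by cycle minimum, larger letter first within a cycle.
  have hm : StrictMono (w' * w⁻¹) := by
    intro i j hij
    obtain ⟨p, rfl⟩ := w.surjective i
    obtain ⟨q, rfl⟩ := w.surjective j
    simp only [Equiv.Perm.mul_apply, Equiv.Perm.inv_eq_iff_eq.2 (rfl : w p = w p),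
      Equiv.Perm.inv_eq_iff_eq.2 (rfl : w q = w q)]
    apply h'.lt_of_min_lt hx hno'
    have h1 := fun h => hij.not_gt (AtomLike.lt_of_min_lt hx ‹_› hno (p := q) (q := p) h)
    have h2 : p ≠ q := by rintro rfl; exact hij.false
    grind
  have : w' * w⁻¹ = 1 := Equiv.ext (congrFun hm.eq_id)
  exact (mul_inv_eq_one.1 this).symm

/-- Conjugation by the order-reversing permutation. -/
def revConj (w : Equiv.Perm (Fin n)) : Equiv.Perm (Fin n) := Fin.revPerm * w * Fin.revPerm

theorem revConj_apply (w : Equiv.Perm (Fin n)) (a : Fin n) :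
    revConj w a = Fin.rev (w (Fin.rev a)) := rfl

theorem revConj_injective : Function.Injective (revConj (n := n)) := fun _ _ h =>
  mul_left_cancel (mul_right_cancel h)

theorem revConj_inv {x : Equiv.Perm (Fin n)} (hx : x⁻¹ = x) : (revConj x)⁻¹ = revConj x := by
  have : (Fin.revPerm : Equiv.Perm (Fin n))⁻¹ = Fin.revPerm := rfl
  rw [revConj, mul_inv_rev, mul_inv_rev, hx, this, mul_assoc]

/-- Reversal exchanges the endpoints of each cycle and the order of positions. The condition `gap`
is self-dual: no letter between the endpoints in value stands between them in position. -/
theorem AtomLike.revConj {x w : Equiv.Perm (Fin n)} (hx : x⁻¹ = x) (h : AtomLike x w) :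
    AtomLike (revConj x) (revConj w) := by
  have xx := apply_apply_of_inv_eq hx
  constructor
  · intro a
    obtain ⟨a, rfl⟩ := Fin.rev_surjective a
    simp only [revConj_apply, Fin.rev_rev, Fin.rev_lt_rev]
    intro ha
    simpa [xx] using h.desc (x a) (by rwa [xx])
  · intro a e
    obtain ⟨a, rfl⟩ := Fin.rev_surjective a
    obtain ⟨e, rfl⟩ := Fin.rev_surjective e
    simp only [revConj_apply, Fin.rev_rev, Fin.rev_lt_rev]
    intro h1 h2 h3
    have h4 := h.gap (x a) e h2
    rw [xx] at h4
    have h5 := w.injective.ne h1.ne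
    have h6 := w.injective.ne h2.ne
    by_contra h7
    exact (h4 h1 (lt_of_le_of_ne (not_lt.1 h7) h5.symm)).not_gt h3
  · intro a c
    obtain ⟨a, rfl⟩ := Fin.rev_surjective a
    obtain ⟨c, rfl⟩ := Fin.rev_surjective c
    simp only [revConj_apply, Fin.rev_rev, Fin.rev_lt_rev, Fin.rev_le_rev]
    intro h1 h2 h3 h4
    have := h.sep (x c) (x a)
    rw [xx, xx] at this
    exact this h2 h1 h4 h3

theorem AvoidsCAB.revConj {w : Equiv.Perm (Fin n)} (h : AvoidsCAB w) : AvoidsBCA (revConj w) := by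
  intro a b c
  obtain ⟨a, rfl⟩ := Fin.rev_surjective a
  obtain ⟨b, rfl⟩ := Fin.rev_surjective b
  obtain ⟨c, rfl⟩ := Fin.rev_surjective c
  simp only [revConj_apply, Fin.rev_rev, Fin.rev_lt_rev, Fin.val_rev]
  intro h1 h2 h3 h4
  exact h c b a h2 h1 (by omega) (by omega)

theorem AtomLike.eq_of_avoidsCAB {x w w' : Equiv.Perm (Fin n)} (hx : x⁻¹ = x)
    (h : AtomLike x w) (hno : AvoidsCAB w) (h' : AtomLike x w') (hno' : AvoidsCAB w') :
    w = w' :=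
  revConj_injective ((h.revConj hx).eq_of_avoidsBCA (revConj_inv hx) hno.revConj (h'.revConj hx)
    hno'.revConj)

end Extremal

/-! ### Moves and the order on one-line representations -/

section OneLine

variable {n : ℕ}

theorem exists_atomMove {w : Equiv.Perm (Fin n)} {a b c : Fin n} (hab : a < b) (hbc : b < c)
    (ha : (w a : ℕ) = w c + 1) (hb : (w b : ℕ) = w a + 1) : ∃ w', AtomMove w w' a b c := by
  have hac := hab.trans hbc
  -- The three-cycle `b ↦ c ↦ a ↦ b`.
  refine ⟨w * (Equiv.swap a b * Equiv.swap b c), hab, hbc, ha, by omega, ?_, ?_, ?_, ?_⟩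
  · simp [Equiv.swap_apply_of_ne_of_ne hac.ne' hbc.ne']
  · simp
  · simp [Equiv.swap_apply_of_ne_of_ne hab.ne hac.ne]
  · intro p pa pb pc
    simp [Equiv.swap_apply_of_ne_of_ne pb pc, Equiv.swap_apply_of_ne_of_ne pa pb]

theorem exists_atomMove_symm {w : Equiv.Perm (Fin n)} {a b c : Fin n} (hab : a < b) (hbc : b < c)
    (hc : (w c : ℕ) = w b + 1) (ha : (w a : ℕ) = w c + 1) : ∃ w', AtomMove w' w a b c := by
  have hac := hab.trans hbc
  have ea : (Equiv.swap b c * Equiv.swap a b) a = c := by simp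
  have eb : (Equiv.swap b c * Equiv.swap a b) b = a := by
    simp [Equiv.swap_apply_of_ne_of_ne hab.ne hac.ne]
  have ec : (Equiv.swap b c * Equiv.swap a b) c = b := by
    simp [Equiv.swap_apply_of_ne_of_ne hac.ne' hbc.ne']
  refine ⟨w * (Equiv.swap b c * Equiv.swap a b), hab, hbc, ?_, ?_, ?_, ?_, ?_, ?_⟩ <;>
    simp only [Equiv.Perm.mul_apply w, ea, eb, ec]
  · omega
  · omega
  · intro p pa pb pc
    simp [Equiv.swap_apply_of_ne_of_ne pb pc, Equiv.swap_apply_of_ne_of_ne pa pb]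

theorem length_oneLine (u : Equiv.Perm (Fin n)) : (oneLine u).length = n := by simp [oneLine]

theorem getElem_oneLine (u : Equiv.Perm (Fin n)) {j : ℕ} (hj : j < (oneLine u).length) :
    (oneLine u)[j] = ((u ⟨j, by rwa [length_oneLine] at hj⟩ : ℕ) : ℤ) := by simp [oneLine]

theorem oneLine_injective : Function.Injective (oneLine (n := n)) := by
  intro u v h
  refine Equiv.ext fun i => Fin.ext ?_
  have := congrFun (List.ofFn_injective h) i
  exact_mod_cast this

theorem AtomMove.apply_pos {u v : Equiv.Perm (Fin n)} {a b c : Fin n}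
    (m : AtomMove u⁻¹ v⁻¹ a b c) : v (u⁻¹ c) = b ∧ v (u⁻¹ a) = c ∧ v (u⁻¹ b) = a ∧
      ∀ j, j ≠ u⁻¹ a → j ≠ u⁻¹ b → j ≠ u⁻¹ c → v j = u j := by
  refine ⟨(Equiv.Perm.inv_eq_iff_eq.1 m.pos_b').symm, (Equiv.Perm.inv_eq_iff_eq.1 m.pos_c').symm,
    (Equiv.Perm.inv_eq_iff_eq.1 m.pos_a').symm, fun j ja jb jc => ?_⟩
  have h : u⁻¹ (u j) = j := Equiv.Perm.inv_eq_iff_eq.2 rfl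
  have := m.pos_of_ne (u j) (fun e => ja (by rw [← e, h])) (fun e => jb (by rw [← e, h]))
    (fun e => jc (by rw [← e, h]))
  rw [h] at this
  exact (Equiv.Perm.inv_eq_iff_eq.1 this).symm

theorem AtomMove.oneLine_eq {u v : Equiv.Perm (Fin n)} {a b c : Fin n}
    (m : AtomMove u⁻¹ v⁻¹ a b c) {p q : List ℤ} (hp : p.length = (u⁻¹ c : Fin n))
    (hu : oneLine u = p ++ [((c : ℕ) : ℤ), ((a : ℕ) : ℤ), ((b : ℕ) : ℤ)] ++ q) :
    oneLine v = p ++ [((b : ℕ) : ℤ), ((c : ℕ) : ℤ), ((a : ℕ) : ℤ)] ++ q := by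
  have hlen := congrArg List.length hu
  simp only [length_oneLine, List.length_append, List.length_cons, List.length_nil] at hlen
  obtain ⟨m1, m2, m3, m4⟩ := m.apply_pos
  have pa := m.pos_a
  have pb := m.pos_b
  rw [← hp] at pa pb
  refine List.ext_getElem (by simp [length_oneLine]; omega) fun j hj _ => ?_
  rw [getElem_oneLine]
  have hjn : j < n := by rwa [length_oneLine] at hj
  have huj := List.getElem_of_eq hu (i := j) (by rwa [length_oneLine])
  rw [getElem_oneLine] at huj
  by_cases j0 : j = p.length
  · have : (⟨j, hjn⟩ : Fin n) = u⁻¹ c := Fin.ext (j0.trans hp)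
    rw [this, m1]
    subst j0
    simp
  by_cases j1 : j = p.length + 1
  · have : (⟨j, hjn⟩ : Fin n) = u⁻¹ a := Fin.ext (j1.trans pa.symm)
    rw [this, m2]
    subst j1
    simp
  by_cases j2 : j = p.length + 2
  · have : (⟨j, hjn⟩ : Fin n) = u⁻¹ b := Fin.ext (j2.trans pb.symm)
    rw [this, m3]
    subst j2
    simp
  · rw [m4 _ (fun e => j1 ?_) (fun e => j2 ?_) (fun e => j0 ?_), huj]
    · rcases lt_or_gt_of_ne j0 with h | h
      · grind
      · grind
    · rw [← pa, ← e]
    · rw [← pb, ← e]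
    · rw [hp, ← e]

theorem AtomMove.seqStep {u v : Equiv.Perm (Fin n)} {a b c : Fin n}
    (m : AtomMove u⁻¹ v⁻¹ a b c) : SeqStep (oneLine u) (oneLine v) := by
  have hpos : ∀ p, u (u⁻¹ p) = p := fun p => (Equiv.Perm.inv_eq_iff_eq.1 rfl).symm
  have pa := m.pos_a
  have pb := m.pos_b
  have hb := (u⁻¹ b).isLt
  have hlen := length_oneLine u
  have hu : oneLine u = (oneLine u).take (u⁻¹ c : Fin n) ++
      [((c : ℕ) : ℤ), ((a : ℕ) : ℤ), ((b : ℕ) : ℤ)] ++ (oneLine u).drop ((u⁻¹ c : Fin n) + 3) := by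
    have e : ∀ r : Fin n, (oneLine u)[(u⁻¹ r : Fin n).val]'(by rw [hlen]; exact (u⁻¹ r).isLt) =
        ((r : ℕ) : ℤ) := fun r => by rw [getElem_oneLine]; simp only [Fin.eta, hpos]
    have ec := e c
    have ea := e a
    have eb := e b
    simp only [pa] at ea
    simp only [pb] at eb
    rw [← ec, ← ea, ← eb, List.append_assoc, List.cons_append, List.cons_append, List.cons_append,
      List.nil_append, ← List.drop_eq_getElem_cons, ← List.drop_eq_getElem_cons,
      ← List.drop_eq_getElem_cons, List.take_append_drop]
  refine ⟨_, _, _, _, _, ?_, ?_, hu, m.oneLine_eq ?_ hu⟩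
  · exact_mod_cast m.lt_ab.le
  · exact_mod_cast m.lt_bc.le
  · rw [List.length_take, hlen]; omega

/-- The entries of a one-line word are distinct, so the weak inequalities of `SeqStep` become
strict, and a step from a permutation leads to a permutation. -/
theorem SeqStep.exists_atomMove {u : Equiv.Perm (Fin n)} {m : List ℤ} (h : SeqStep (oneLine u) m) :
    ∃ v a b c, oneLine v = m ∧ AtomMove u⁻¹ v⁻¹ a b c := by
  obtain ⟨p, q, a', b', c', hab, hbc, hu, rfl⟩ := h
  have hlen := congrArg List.length hu
  simp only [length_oneLine, List.length_append, List.length_cons, List.length_nil] at hlen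
  have k0 : p.length < n := by omega
  have k1 : p.length + 1 < n := by omega
  have k2 : p.length + 2 < n := by omega
  have e0 := List.getElem_of_eq hu (i := p.length) (by rwa [length_oneLine])
  have e1 := List.getElem_of_eq hu (i := p.length + 1) (by rwa [length_oneLine])
  have e2 := List.getElem_of_eq hu (i := p.length + 2) (by rwa [length_oneLine])
  rw [getElem_oneLine] at e0 e1 e2
  simp at e0 e1 e2
  have hpos : ∀ p, u⁻¹ (u p) = p := fun p => Equiv.Perm.inv_eq_iff_eq.2 rfl
  have n1 := u.injective.ne (a₁ := ⟨_, k1⟩) (a₂ := ⟨_, k2⟩) (by simp)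
  have n2 := u.injective.ne (a₁ := ⟨_, k2⟩) (a₂ := ⟨_, k0⟩) (by simp)
  obtain ⟨w', hw'⟩ := _root_.exists_atomMove (w := u⁻¹) (a := u ⟨_, k1⟩) (b := u ⟨_, k2⟩)
    (c := u ⟨_, k0⟩) (lt_of_le_of_ne (by rw [Fin.le_def]; omega) n1)
    (lt_of_le_of_ne (by rw [Fin.le_def]; omega) n2) (by simp [hpos]) (by simp [hpos])
  rw [← inv_inv w'] at hw'
  refine ⟨w'⁻¹, _, _, _, ?_, hw'⟩
  rw [← e0, ← e1, ← e2] at hu ⊢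
  exact hw'.oneLine_eq (by rw [hpos]) hu

end OneLine

/-! ### The poset of inverse atoms -/

section Poset

variable {n : ℕ} {x : Equiv.Perm (Fin n)}

theorem InvAtoms.atomLike (hx : x⁻¹ = x) (u : InvAtoms x) : AtomLike x u.1⁻¹ :=
  (mem_involutionAtoms_iff hx _).1 u.2

theorem AtomMove.lt {u v : InvAtoms x} {a b c : Fin n} (m : AtomMove u.1⁻¹ v.1⁻¹ a b c) : u < v :=
  Relation.TransGen.single m.seqStep

instance InvAtoms.instFinite : Finite (InvAtoms x) :=
  inferInstanceAs (Finite {u : Equiv.Perm (Fin n) // u⁻¹ ∈ involutionAtoms x})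

theorem InvAtoms.nonempty (hx : x⁻¹ = x) : Nonempty (InvAtoms x) := by
  obtain ⟨w, hw⟩ := exists_atomLike hx
  exact ⟨⟨w⁻¹, (mem_involutionAtoms_iff hx _).2 (by rwa [inv_inv])⟩⟩

/-- An occurrence of the pattern can be undone inside the finite poset, giving a smaller element. -/
theorem InvAtoms.exists_le_avoidsBCA (hx : x⁻¹ = x) (u : InvAtoms x) :
    ∃ v : InvAtoms x, v ≤ u ∧ AvoidsBCA v.1⁻¹ := by
  induction u using WellFoundedLT.induction with
  | _ u ih =>
    by_cases h : AvoidsBCA u.1⁻¹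
    · exact ⟨u, le_rfl, h⟩
    simp only [AvoidsBCA, not_forall] at h
    obtain ⟨a, b, c, hab, hbc, hc, ha, -⟩ := h
    obtain ⟨w, m⟩ := exists_atomMove_symm hab hbc hc ha
    have hw := m.atomLike_symm hx (u.atomLike hx)
    rw [← inv_inv w] at m hw
    let v : InvAtoms x := ⟨w⁻¹, (mem_involutionAtoms_iff hx _).2 hw⟩
    have hv : v < u := AtomMove.lt (u := v) m
    obtain ⟨t, h1, h2⟩ := ih v hv
    exact ⟨t, h1.trans hv.le, h2⟩

theorem InvAtoms.exists_ge_avoidsCAB (hx : x⁻¹ = x) (u : InvAtoms x) :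
    ∃ v : InvAtoms x, u ≤ v ∧ AvoidsCAB v.1⁻¹ := by
  induction u using WellFoundedGT.induction with
  | _ u ih =>
    by_cases h : AvoidsCAB u.1⁻¹
    · exact ⟨u, le_rfl, h⟩
    simp only [AvoidsCAB, not_forall] at h
    obtain ⟨a, b, c, hab, hbc, ha, hb, -⟩ := h
    obtain ⟨w, m⟩ := exists_atomMove hab hbc ha hb
    have hw := m.atomLike hx (u.atomLike hx)
    rw [← inv_inv w] at m hw
    let v : InvAtoms x := ⟨w⁻¹, (mem_involutionAtoms_iff hx _).2 hw⟩
    have hv : u < v := AtomMove.lt (v := v) m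
    obtain ⟨t, h1, h2⟩ := ih v hv
    exact ⟨t, hv.le.trans h1, h2⟩

theorem isBoundedPoset_invAtoms (hx : x⁻¹ = x) : IsBoundedPoset (InvAtoms x) := by
  obtain ⟨u⟩ := InvAtoms.nonempty hx
  constructor
  · obtain ⟨m, -, hm⟩ := u.exists_le_avoidsBCA hx
    refine ⟨m, fun v => ?_⟩
    obtain ⟨t, h1, h2⟩ := v.exists_le_avoidsBCA hx
    rwa [Subtype.ext (inv_injective
      ((t.atomLike hx).eq_of_avoidsBCA hx h2 (m.atomLike hx) hm)) (a1 := t)] at h1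
  · obtain ⟨m, -, hm⟩ := u.exists_ge_avoidsCAB hx
    refine ⟨m, fun v => ?_⟩
    obtain ⟨t, h1, h2⟩ := v.exists_ge_avoidsCAB hx
    rwa [Subtype.ext (inv_injective
      ((t.atomLike hx).eq_of_avoidsCAB hx h2 (m.atomLike hx) hm)) (a1 := t)] at h1

/-- The first step of a chain from `u` to `v` ends at an inverse atom, which for a cover can only be
`v`. -/
theorem isRankFunction_card_atomInv (hx : x⁻¹ = x) :
    IsRankFunction (fun u : InvAtoms x => (atomInv u.1 x).card) := by
  intro u v huv
  obtain ⟨l, hl, hlv⟩ := Relation.TransGen.head'_iff.1 (show SeqPrec _ _ from huv.lt)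
  obtain ⟨t, a, b, c, rfl, m⟩ := hl.exists_atomMove
  let t' : InvAtoms x := ⟨t, (mem_involutionAtoms_iff hx _).2 (m.atomLike hx (u.atomLike hx))⟩
  rcases Relation.reflTransGen_iff_eq_or_transGen.1 hlv with h | h
  · have e := oneLine_injective h
    rw [← e] at m
    exact m.card_atomInv hx (u.atomLike hx)
  · exact absurd (show t' < v from h) (huv.2 (AtomMove.lt (v := t') m))

end Poset

theorem proposition6p15 (n : ℕ) (x : Equiv.Perm (Fin n)) (hx : x⁻¹ = x) :
    IsGradedPoset (InvAtoms x) ∧ IsBoundedPoset (InvAtoms x) ∧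
      IsRankFunction (fun u : InvAtoms x => (atomInv u.1 x).card) :=
  ⟨⟨_, isRankFunction_card_atomInv hx⟩, isBoundedPoset_invAtoms hx, isRankFunction_card_atomInv hx⟩
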